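/- Let $n\ge m\ge 2$ be integers. Let $\mathcal W$ be the set of mixed states of the bipartite $m\times n$ quantum system, i.e. of all positive semidefinite Hermitian operators of trace $1$ on $\mathbb C^m\otimes\mathbb C^n$, and let the group $\mathrm U(m)\otimes\mathrm U(n)=\{U\otimes V : U\in \mathrm U(m),\ V\in \mathrm U(n)\}\subseteq \mathrm U(mn)$ of local unitary transformations act on $\mathcal W$ by $(g,W)\mapsto gWg^\dagger$. Then: (1) Every orbit in $\mathcal W$ is an embedded smooth submanifold of the space of operators on $\mathbb C^m\otimes\mathbb C^n$, and the maximum of the dimensions of these orbits is $m^2+n^2-2$. (2) The minimal isotropy subgroup is exactly the center of $\mathrm U(m)\otimes\mathrm U(n)$: the isotropy subgroup of every $W\in\mathcal W$ contains this center, and there is a $W\in\mathcal W$ whose isotropy subgroup is equal to it. (3) The orbit of every $W\in\mathcal W$ whose isotropy subgroup is the center (these are the orbits of principal type, also called generic) has dimension $m^2+n^2-2$ and is diffeomorphic to the product manifold $\mathrm{SU}(m)/Z_m\times\mathrm{SU}(n)/Z_n$, where $Z_k$ denotes the center of $\mathrm{SU}(k)$. -/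

import Mathlib

open Matrix Manifold
open scoped Kronecker ContDiff ComplexOrder Matrix.Norms.Frobenius

/-- Operators on `ℂ^m ⊗ ℂ^n`, as matrices in the product basis. As a real normed space it carries
the Hilbert–Schmidt (Frobenius) norm. -/
abbrev Operator (m n : ℕ) : Type := Matrix (Fin m × Fin n) (Fin m × Fin n) ℂ

/-- The set of mixed states of the bipartite `m × n` system: positive semidefinite Hermitian
operators of trace one. -/
abbrev MixedState (m n : ℕ) : Type := {W : Operator m n // W.PosSemidef ∧ W.trace = 1}

/-- Unitary operators act on mixed states by `(g, W) ↦ g W g†`. -/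
instance MixedState.mulAction (m n : ℕ) :
    MulAction (unitaryGroup (Fin m × Fin n) ℂ) (MixedState m n) where
  smul g W := ⟨(g : Operator m n) * W.1 * (g : Operator m n)ᴴ,
    W.2.1.mul_mul_conjTranspose_same _, by
      have h : (g : Operator m n)ᴴ * (g : Operator m n) = 1 := (Unitary.mem_iff.1 g.2).1
      rw [trace_mul_comm, ← mul_assoc, h, one_mul, W.2.2]⟩
  one_smul W := Subtype.ext (by
    change (1 : Operator m n) * W.1 * (1 : Operator m n)ᴴ = W.1
    simp)
  mul_smul g h W := Subtype.ext (by
    change ((g : Operator m n) * (h : Operator m n)) * W.1 *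
        ((g : Operator m n) * (h : Operator m n))ᴴ =
      (g : Operator m n) * ((h : Operator m n) * W.1 * (h : Operator m n)ᴴ) * (g : Operator m n)ᴴ
    simp only [conjTranspose_mul, mul_assoc])

theorem MixedState.coe_smul {m n : ℕ} (g : unitaryGroup (Fin m × Fin n) ℂ) (W : MixedState m n) :
    ((g • W : MixedState m n) : Operator m n) =
      (g : Operator m n) * (W : Operator m n) * (g : Operator m n)ᴴ := rfl

/-- The group `U(m) ⊗ U(n)` of local unitary transformations: all `U ⊗ V` with `U ∈ U(m)` and
`V ∈ U(n)`, as a subgroup of `U(mn)`. -/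
def localUnitaryGroup (m n : ℕ) : Subgroup (unitaryGroup (Fin m × Fin n) ℂ) where
  carrier := {g | ∃ U ∈ unitaryGroup (Fin m) ℂ, ∃ V ∈ unitaryGroup (Fin n) ℂ,
    (g : Operator m n) = U ⊗ₖ V}
  mul_mem' := by
    rintro g h ⟨U, hU, V, hV, hg⟩ ⟨U', hU', V', hV', hh⟩
    refine ⟨U * U', mul_mem hU hU', V * V', mul_mem hV hV', ?_⟩
    rw [Submonoid.coe_mul, hg, hh, mul_kronecker_mul]
  one_mem' := ⟨1, one_mem _, 1, one_mem _, by simp⟩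
  inv_mem' := by
    rintro g ⟨U, hU, V, hV, hg⟩
    refine ⟨star U, Unitary.star_mem hU, star V, Unitary.star_mem hV, ?_⟩
    change star (g : Operator m n) = _
    rw [hg, star_eq_conjTranspose, conjTranspose_kronecker]
    rfl

/-- The orbit of the mixed state `W` under local unitary transformations. -/
abbrev localOrbit {m n : ℕ} (W : MixedState m n) : Set (MixedState m n) :=
  MulAction.orbit (localUnitaryGroup m n) W

/-- The isotropy subgroup of the mixed state `W` in the group of local unitary transformations. -/
abbrev isotropyGroup {m n : ℕ} (W : MixedState m n) : Subgroup (localUnitaryGroup m n) :=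
  MulAction.stabilizer (localUnitaryGroup m n) W

/-- The inclusion of the orbit of `W` into the space of operators. -/
def orbitInclusion {m n : ℕ} (W : MixedState m n) : localOrbit W → Operator m n :=
  fun X => ((X : MixedState m n) : Operator m n)

/-- The atlas `c` makes `X` a smooth `d`-dimensional manifold and `ι : X → E` a smooth embedding,
that is, `c` is the smooth structure of `X` as an embedded submanifold of the vector space `E`.
Any two such atlases have the same maximal smooth atlas. -/
structure IsSubmanifoldAtlas {X E : Type*} [TopologicalSpace X] [NormedAddCommGroup E]
    [NormedSpace ℝ E] {d : ℕ} (ι : X → E) (c : ChartedSpace (EuclideanSpace ℝ (Fin d)) X) :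
    Prop where
  isManifold : IsManifold (𝓡 d) ∞ X
  isSmoothEmbedding : IsSmoothEmbedding (𝓡 d) 𝓘(ℝ, E) ∞ ι

/-- The atlas `q` makes `Y` a smooth `d`-dimensional manifold and `π : X → Y` a local
diffeomorphism from the manifold `(X, c)`. If `π` is the projection of `X` onto its quotient by a
finite group, `q` is the smooth structure of the quotient manifold.
For surjective `π`, any two such atlases have the same maximal smooth atlas. -/
structure IsQuotientAtlas {X Y : Type*} [TopologicalSpace X] [TopologicalSpace Y] {d : ℕ}
    (π : X → Y) (c : ChartedSpace (EuclideanSpace ℝ (Fin d)) X)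
    (q : ChartedSpace (EuclideanSpace ℝ (Fin d)) Y) : Prop where
  isManifold : IsManifold (𝓡 d) ∞ Y
  isLocalDiffeomorph : IsLocalDiffeomorph (𝓡 d) (𝓡 d) ∞ π

/-- The orbit of `W` is an embedded smooth submanifold of dimension `d` of the space of
operators. -/
def OrbitHasDim {m n : ℕ} (W : MixedState m n) (d : ℕ) : Prop :=
  ∃ c : ChartedSpace (EuclideanSpace ℝ (Fin d)) (localOrbit W),
    IsSubmanifoldAtlas (orbitInclusion W) c

/-- The special unitary group `SU(k)`. -/
abbrev SU (k : ℕ) : Type := specialUnitaryGroup (Fin k) ℂ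

/-- The quotient `SU(k) / Z_k` of `SU(k)` by its center, with the quotient topology. -/
abbrev PSU (k : ℕ) : Type := SU k ⧸ Subgroup.center (SU k)

/-- The inclusion of `SU(k)` into the space of `k × k` complex matrices. -/
def suInclusion (k : ℕ) : SU k → Matrix (Fin k) (Fin k) ℂ := fun U => U.1

/-- `q` is the smooth structure of the manifold `SU(k) / Z_k`: the one for which the projection
`SU(k) → SU(k) / Z_k` is a local diffeomorphism, where `SU(k)` has its smooth structure as an
embedded submanifold of the space of matrices. -/
def IsPSUAtlas (k : ℕ) (q : ChartedSpace (EuclideanSpace ℝ (Fin (k ^ 2 - 1))) (PSU k)) : Prop :=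
  ∃ c : ChartedSpace (EuclideanSpace ℝ (Fin (k ^ 2 - 1))) (SU k),
    IsSubmanifoldAtlas (suInclusion k) c ∧
      IsQuotientAtlas (QuotientGroup.mk : SU k → PSU k) c q

/-! Phases cancel in `g W g†`, and every local unitary is a phase times some `U ⊗ V` with `U`, `V`
special unitary (`exists_localHom_eq_smul`). So each orbit is a homogeneous space of the compact
group `SU(m) × SU(n)`, lying in a vector space on which the group acts linearly.

Such a space is an embedded submanifold. The derivative of the orbit map at the origin of `su(m) ×
su(n)` is `a ↦ [a, W]`, whose kernel is the Lie algebra of the isotropy group. On a complement of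
this kernel the exponential map parametrizes the orbit near `W`: the inverse function theorem
straightens the orbit inside the space of operators, and an open mapping theorem for the action of a
compact group shows that the image is a neighbourhood of `W` in the orbit
(`IsExpCoord.exists_isSliceChart`). Translates of this one chart form the atlas. The orbit dimension
is the codimension of the kernel, hence at most `(m² - 1) + (n² - 1)`.

If the isotropy group is the center, every one-parameter group `exp (t a)` fixing `W` is scalar, so
the traceless `a` vanishes and the bound is attained. The orbit map then descends to a bijection
from `SU(m)/Z_m × SU(n)/Z_n` which is linear in exponential coordinates, hence a diffeomorphism
(`exists_diffeomorph_localOrbit`).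

A state with central isotropy is obtained by shifting and normalizing `ladder ⊗ 1 + 1 ⊗ ladder +
coupling ⊗ coupling`. Partial traces isolate the ladders and force `U`, `V` to be diagonal; the
coupling term then forces them to be scalar (`SU.mem_center_of_conj_genericOperator`). -/

open Set Filter Topology

/-! ### Manifold structures on homogeneous spaces -/

namespace OpenPartialHomeomorph

variable {G V X : Type*} [Group G] [TopologicalSpace V] [TopologicalSpace X] [MulAction G X]
  [ContinuousConstSMul G X]

/-- The translate of a local parametrization of `X` by a group element acting on `X`. -/
def translate (κ : OpenPartialHomeomorph V X) (g : G) : OpenPartialHomeomorph V X :=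
  κ.transHomeomorph (Homeomorph.smul g)

@[simp] theorem translate_apply (κ : OpenPartialHomeomorph V X) (g : G) (v : V) :
    κ.translate g v = g • κ v := rfl

@[simp] theorem translate_symm_apply (κ : OpenPartialHomeomorph V X) (g : G) (x : X) :
    (κ.translate g).symm x = κ.symm (g⁻¹ • x) := rfl

@[simp] theorem translate_source (κ : OpenPartialHomeomorph V X) (g : G) :
    (κ.translate g).source = κ.source := rfl

@[simp] theorem mem_translate_target (κ : OpenPartialHomeomorph V X) (g : G) (x : X) :
    x ∈ (κ.translate g).target ↔ g⁻¹ • x ∈ κ.target := Iff.rfl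

/-- The atlas consisting of the translates of one chart on a homogeneous space. -/
@[reducible] noncomputable def homogeneousChartedSpace [MulAction.IsPretransitive G X]
    (κ : OpenPartialHomeomorph V X) {v₀ : V} (h₀ : v₀ ∈ κ.source) : ChartedSpace V X where
  atlas := range fun g : G => (κ.translate g).symm
  chartAt x := (κ.translate (MulAction.exists_smul_eq G (κ v₀) x).choose).symm
  mem_chart_source x := by
    have h := (MulAction.exists_smul_eq G (κ v₀) x).choose_spec
    refine (mem_translate_target κ _ x).2 ?_
    rw [inv_smul_eq_iff.2 h.symm]
    exact κ.map_source h₀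
  chart_mem_atlas x := mem_range_self _

end OpenPartialHomeomorph

open OpenPartialHomeomorph

/-- In the chart `κ⁻¹` of `X` and the chart `Φ` of `E`, the map `ι` is the inclusion of a
coordinate subspace. -/
structure IsSliceChart {X V F E : Type*} [TopologicalSpace X] [NormedAddCommGroup V]
    [NormedSpace ℝ V] [NormedAddCommGroup F] [NormedSpace ℝ F] [NormedAddCommGroup E]
    [NormedSpace ℝ E] (ι : X → E) (κ : OpenPartialHomeomorph V X) (L : (V × F) ≃L[ℝ] E)
    (Φ : OpenPartialHomeomorph E E) : Prop where
  contDiffOn : ContDiffOn ℝ ∞ Φ Φ.source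
  contDiffOn_symm : ContDiffOn ℝ ∞ Φ.symm Φ.target
  mapsTo : MapsTo ι κ.target Φ.source
  apply_eq : ∀ x ∈ κ.target, Φ (ι x) = L (κ.symm x, 0)

section Homogeneous

variable {G X V F E : Type*} [Group G] [TopologicalSpace X] [MulAction G X]
  [ContinuousConstSMul G X] [MulAction.IsPretransitive G X]
  [NormedAddCommGroup V] [NormedSpace ℝ V] [NormedAddCommGroup F] [NormedSpace ℝ F]
  [NormedAddCommGroup E] [NormedSpace ℝ E]
  {ι : X → E} {κ : OpenPartialHomeomorph V X} {L : (V × F) ≃L[ℝ] E}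
  {Φ : OpenPartialHomeomorph E E} {v₀ : V}

namespace IsSliceChart

theorem symm_apply (h : IsSliceChart ι κ L Φ) {v : V} (hv : v ∈ κ.source) :
    Φ.symm (L (v, 0)) = ι (κ v) := by
  have := h.apply_eq _ (κ.map_source hv)
  rw [κ.left_inv hv] at this
  rw [← this, Φ.left_inv (h.mapsTo (κ.map_source hv))]

theorem mem_target (h : IsSliceChart ι κ L Φ) {v : V} (hv : v ∈ κ.source) :
    L (v, 0) ∈ Φ.target := by
  have := h.apply_eq _ (κ.map_source hv)
  rw [κ.left_inv hv] at this
  exact this ▸ Φ.map_source (h.mapsTo (κ.map_source hv))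

/-- Since the action extends to linear maps of `E`, a transition map between two translates factors
through `E`: include by `Φ.symm ∘ L`, apply `T (g'⁻¹ * g)`, return by `Φ` and project. Each factor
is smooth. -/
theorem isManifold (h : IsSliceChart ι κ L Φ) (T : G → E ≃L[ℝ] E)
    (hT : ∀ g x, ι (g • x) = T g (ι x)) (h₀ : v₀ ∈ κ.source) :
    letI := homogeneousChartedSpace (G := G) κ h₀
    IsManifold 𝓘(ℝ, V) ∞ X := by
  let _ := homogeneousChartedSpace (G := G) κ h₀
  refine isManifold_of_contDiffOn _ _ _ ?_
  rintro _ _ ⟨g, rfl⟩ ⟨g', rfl⟩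
  simp only [modelWithCornersSelf_coe, modelWithCornersSelf_coe_symm, Function.comp_id,
    Function.id_comp, preimage_id, range_id, inter_univ]
  have key : ContDiffOn ℝ ∞ (fun v : V => (L.symm (Φ (T (g'⁻¹ * g) (Φ.symm (L (v, 0)))))).1)
      {v | v ∈ κ.source ∧ g'⁻¹ • g • κ v ∈ κ.target} := by
    refine contDiff_fst.comp_contDiffOn (L.symm.contDiff.comp_contDiffOn ?_)
    refine h.contDiffOn.comp ((T _).contDiff.comp_contDiffOn (h.contDiffOn_symm.comp
      (L.contDiff.comp (contDiff_id.prodMk contDiff_const)).contDiffOn ?_)) ?_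
    · exact fun v hv => h.mem_target hv.1
    · intro v hv
      simp only
      rw [h.symm_apply hv.1, ← hT, mul_smul]
      exact h.mapsTo hv.2
  refine (key.congr ?_).mono (fun v hv => ?_)
  · intro v hv
    rw [h.symm_apply hv.1, ← hT, mul_smul, h.apply_eq _ hv.2]
    simp
  · exact ⟨hv.1, hv.2⟩

/-- At `g • κ v₀` the chart `Φ ∘ (T g)⁻¹` of `E` plays the role that `Φ` plays at the base point, so
one slice chart serves all points. -/
theorem isSubmanifoldAtlas_of_equiv {d : ℕ} {κ : OpenPartialHomeomorph (EuclideanSpace ℝ (Fin d)) X}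
    {L : (EuclideanSpace ℝ (Fin d) × F) ≃L[ℝ] E} {v₀ : EuclideanSpace ℝ (Fin d)}
    (h : IsSliceChart ι κ L Φ) (T : G → E ≃L[ℝ] E)
    (hT : ∀ g x, ι (g • x) = T g (ι x)) (h₀ : v₀ ∈ κ.source) (hι : IsEmbedding ι) :
    IsSubmanifoldAtlas ι (homogeneousChartedSpace (G := G) κ h₀) := by
  let _ := homogeneousChartedSpace (G := G) κ h₀
  have hman : IsManifold (𝓡 d) ∞ X := h.isManifold T hT h₀
  refine ⟨hman, ⟨?_, hι⟩⟩
  refine IsImmersionOfComplement.isImmersion (F := F) fun x => ?_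
  obtain ⟨g, hg⟩ := MulAction.exists_smul_eq G (κ v₀) x
  refine IsImmersionAtOfComplement.mk_of_charts L (κ.translate g).symm
    ((T g).toHomeomorph.symm.toOpenPartialHomeomorph.trans Φ) ?_ ?_ ?_ ?_ ?_ ?_
  · change g⁻¹ • x ∈ κ.target
    rw [← hg, inv_smul_smul]
    exact κ.map_source h₀
  · rw [← hg, hT]
    simpa using h.mapsTo (κ.map_source h₀)
  · exact IsManifold.subset_maximalAtlas (mem_range_self g)
  · refine StructureGroupoid.mem_maximalAtlas_of_mem_groupoid _ ?_
    rw [contDiffGroupoid, mem_groupoid_of_pregroupoid]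
    constructor
    · simp only [contDiffPregroupoid, modelWithCornersSelf_coe, modelWithCornersSelf_coe_symm,
        Function.comp_id, Function.id_comp, preimage_id, range_id, inter_univ]
      exact h.contDiffOn.comp (T g).symm.contDiff.contDiffOn (fun x hx => by simpa using hx)
    · simp only [contDiffPregroupoid, modelWithCornersSelf_coe, modelWithCornersSelf_coe_symm,
        Function.comp_id, Function.id_comp, preimage_id, range_id, inter_univ]
      exact (T g).contDiff.comp_contDiffOn (h.contDiffOn_symm.mono (fun x hx => hx.1))
  · intro y hy
    have hy' : g⁻¹ • y ∈ κ.target := hy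
    have : ι y = T g (ι (g⁻¹ • y)) := by rw [← hT, smul_inv_smul]
    simp only [mem_preimage]
    rw [this]
    simpa using h.mapsTo hy'
  · intro v hv
    have hv' : v ∈ κ.source := by simpa using hv
    have : (T g).symm (ι (g • κ v)) = ι (κ v) := by rw [hT]; simp
    change Φ ((T g).symm (ι (g • κ v))) = L (v, 0)
    rw [this, h.apply_eq _ (κ.map_source hv'), κ.left_inv hv']

end IsSliceChart

end Homogeneous

/-! ### Local diffeomorphisms recognized in smooth parametrizations. -/

section LocalDiffeomorph

variable {V₁ V₂ H₁ H₂ X₁ X₂ E₁ E₂ : Type*} [NormedAddCommGroup V₁] [NormedSpace ℝ V₁]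
  [NormedAddCommGroup V₂] [NormedSpace ℝ V₂] [NormedAddCommGroup E₁] [NormedSpace ℝ E₁]
  [NormedAddCommGroup E₂] [NormedSpace ℝ E₂] [TopologicalSpace H₁] [TopologicalSpace H₂]
  {I₁ : ModelWithCorners ℝ E₁ H₁} {I₂ : ModelWithCorners ℝ E₂ H₂}
  [TopologicalSpace X₁] [ChartedSpace H₁ X₁] [TopologicalSpace X₂] [ChartedSpace H₂ X₂]

/-- A local parametrization of a manifold which is smooth in both directions. -/
structure OpenPartialHomeomorph.IsSmoothParam (I₁ : ModelWithCorners ℝ E₁ H₁)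
    (κ : OpenPartialHomeomorph V₁ X₁) : Prop where
  contMDiffOn : ContMDiffOn 𝓘(ℝ, V₁) I₁ ∞ κ κ.source
  contMDiffOn_symm : ContMDiffOn I₁ 𝓘(ℝ, V₁) ∞ κ.symm κ.target

theorem OpenPartialHomeomorph.IsSmoothParam.prod {κ₁ : OpenPartialHomeomorph V₁ X₁}
    {κ₂ : OpenPartialHomeomorph V₂ X₂} (h₁ : κ₁.IsSmoothParam I₁) (h₂ : κ₂.IsSmoothParam I₂) :
    (κ₁.prod κ₂).IsSmoothParam (I₁.prod I₂) := by
  constructor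
  · have := h₁.contMDiffOn.prodMap h₂.contMDiffOn
    rw [← modelWithCornersSelf_prod, chartedSpaceSelf_prod] at this
    exact this
  · have := h₁.contMDiffOn_symm.prodMap h₂.contMDiffOn_symm
    rw [← modelWithCornersSelf_prod, chartedSpaceSelf_prod] at this
    exact this

/-- A map which is linear in suitable local parametrizations is a local diffeomorphism. -/
theorem OpenPartialHomeomorph.IsSmoothParam.isLocalDiffeomorphAt
    {κ₁ : OpenPartialHomeomorph V₁ X₁} {κ₂ : OpenPartialHomeomorph V₂ X₂}
    (h₁ : κ₁.IsSmoothParam I₁) (h₂ : κ₂.IsSmoothParam I₂) (A : V₁ ≃L[ℝ] V₂) {f : X₁ → X₂}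
    (hf : ∀ v, f (κ₁ v) = κ₂ (A v)) {v : V₁} (hv : v ∈ κ₁.source) (hAv : A v ∈ κ₂.source) :
    IsLocalDiffeomorphAt I₁ I₂ ∞ f (κ₁ v) := by
  let e := κ₁.symm.trans (A.toHomeomorph.toOpenPartialHomeomorph.trans κ₂)
  have hmem : ∀ x, x ∈ e.source ↔ x ∈ κ₁.target ∧ A (κ₁.symm x) ∈ κ₂.source := by
    intro x; simp [e]
  have hmem' : ∀ y, y ∈ e.target ↔ y ∈ κ₂.target ∧ A.symm (κ₂.symm y) ∈ κ₁.source := by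
    intro y; simp [e]
  refine ⟨⟨e.toPartialEquiv, e.open_source, e.open_target, ?_, ?_⟩, ?_, ?_⟩
  · change ContMDiffOn I₁ I₂ ∞ (κ₂ ∘ A ∘ κ₁.symm) e.source
    exact h₂.contMDiffOn.comp (A.contDiff.contMDiff.comp_contMDiffOn
      (h₁.contMDiffOn_symm.mono fun x hx => ((hmem x).1 hx).1)) fun x hx => ((hmem x).1 hx).2
  · change ContMDiffOn I₂ I₁ ∞ (κ₁ ∘ A.symm ∘ κ₂.symm) e.target
    exact h₁.contMDiffOn.comp (A.symm.contDiff.contMDiff.comp_contMDiffOn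
      (h₂.contMDiffOn_symm.mono fun x hx => ((hmem' x).1 hx).1)) fun x hx => ((hmem' x).1 hx).2
  · exact (hmem _).2 ⟨κ₁.map_source hv, by rwa [κ₁.left_inv hv]⟩
  · intro x hx
    change f x = κ₂ (A (κ₁.symm x))
    rw [← hf, κ₁.right_inv ((hmem x).1 hx).1]

end LocalDiffeomorph

section Homogeneous

variable {G X V F E : Type*} [Group G] [TopologicalSpace X] [MulAction G X]
  [ContinuousConstSMul G X] [MulAction.IsPretransitive G X]
  [NormedAddCommGroup V] [NormedSpace ℝ V]

theorem OpenPartialHomeomorph.isSmoothParam_translate {κ : OpenPartialHomeomorph V X} {v₀ : V}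
    (h₀ : v₀ ∈ κ.source)
    (hman : letI := homogeneousChartedSpace (G := G) κ h₀
      IsManifold 𝓘(ℝ, V) ∞ X) (g : G) :
    letI := homogeneousChartedSpace (G := G) κ h₀
    (κ.translate g).IsSmoothParam 𝓘(ℝ, V) := by
  let _ := homogeneousChartedSpace (G := G) κ h₀
  have hmem : (κ.translate g).symm ∈ IsManifold.maximalAtlas 𝓘(ℝ, V) ∞ X :=
    IsManifold.subset_maximalAtlas (mem_range_self g)
  exact ⟨contMDiffOn_symm_of_mem_maximalAtlas hmem, contMDiffOn_of_mem_maximalAtlas hmem⟩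

end Homogeneous

/-! ### Uniqueness of the dimension, and the inverse function theorem. -/

/-- Two embedded submanifold structures on a topological subspace have the same dimension. -/
theorem IsSubmanifoldAtlas.dim_unique {X E : Type*} [TopologicalSpace X] [Nonempty X]
    [NormedAddCommGroup E] [NormedSpace ℝ E] {ι : X → E} {d₁ d₂ : ℕ}
    {c₁ : ChartedSpace (EuclideanSpace ℝ (Fin d₁)) X}
    {c₂ : ChartedSpace (EuclideanSpace ℝ (Fin d₂)) X}
    (h₁ : IsSubmanifoldAtlas ι c₁) (h₂ : IsSubmanifoldAtlas ι c₂) : d₁ = d₂ := by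
  have := h₁.isManifold
  have := h₂.isManifold
  -- A continuous map into an immersed manifold is smooth as soon as its composite with the
  -- immersion is. So the identity is a diffeomorphism between the two structures, and its
  -- derivative compares the dimensions.
  have s₁₂ : @ContMDiff ℝ _ _ _ _ _ _ (𝓡 d₁) X _ c₁ _ _ _ _ _ (𝓡 d₂) X _ c₂ ∞ id :=
    (ContMDiff.iff_comp_isImmersion h₂.isSmoothEmbedding.isImmersion).2
      ⟨continuous_id, h₁.isSmoothEmbedding.contMDiff⟩
  have s₂₁ : @ContMDiff ℝ _ _ _ _ _ _ (𝓡 d₂) X _ c₂ _ _ _ _ _ (𝓡 d₁) X _ c₁ ∞ id :=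
    (ContMDiff.iff_comp_isImmersion h₁.isSmoothEmbedding.isImmersion).2
      ⟨continuous_id, h₂.isSmoothEmbedding.contMDiff⟩
  let Φ : @Diffeomorph ℝ _ _ _ _ _ _ _ _ _ _ _ (𝓡 d₁) (𝓡 d₂) X _ c₁ X _ c₂ ∞ :=
    { toEquiv := Equiv.refl X, contMDiff_toFun := s₁₂, contMDiff_invFun := s₂₁ }
  obtain ⟨x⟩ := ‹Nonempty X›
  have e := (Φ.mfderivToContinuousLinearEquiv (by simp) x).toLinearEquiv.finrank_eq
  change Module.finrank ℝ (EuclideanSpace ℝ (Fin d₁)) =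
    Module.finrank ℝ (EuclideanSpace ℝ (Fin d₂)) at e
  simpa using e

/-- The inverse function theorem for a smooth map, with an inverse that is smooth on its whole
domain. -/
theorem ContDiff.exists_openPartialHomeomorph {E F : Type*} [NormedAddCommGroup E]
    [NormedSpace ℝ E] [CompleteSpace E] [NormedAddCommGroup F] [NormedSpace ℝ F] {f : E → F}
    (hf : ContDiff ℝ ∞ f) {a : E} {f' : E ≃L[ℝ] F} (hf' : HasFDerivAt f (f' : E →L[ℝ] F) a) :
    ∃ P : OpenPartialHomeomorph E F, ⇑P = f ∧ a ∈ P.source ∧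
      ContDiffOn ℝ ∞ P.symm P.target := by
  have h0 : (∞ : WithTop ℕ∞) ≠ 0 := by simp
  let Q := hf.contDiffAt.toOpenPartialHomeomorph f hf' h0
  -- The open set where the derivative is invertible; restricting to it makes the inverse smooth at
  -- every point of its domain, not only at the image of `a`.
  let S : Set E := fderiv ℝ f ⁻¹' range ((↑) : (E ≃L[ℝ] F) → E →L[ℝ] F)
  have hS : IsOpen S := ContinuousLinearEquiv.isOpen.preimage (hf.continuous_fderiv h0)
  refine ⟨Q.restrOpen S hS, rfl, ⟨hf.contDiffAt.mem_toOpenPartialHomeomorph_source hf' h0, ?_⟩, ?_⟩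
  · exact ⟨f', hf'.fderiv.symm⟩
  · intro y hy
    refine ContDiffAt.contDiffWithinAt ?_
    obtain ⟨A, hA⟩ := ((Q.restrOpen S hS).map_target hy).2
    refine (Q.restrOpen S hS).contDiffAt_symm (f₀' := A) hy ?_ hf.contDiffAt
    rw [hA]
    exact (hf.differentiable h0 _).hasFDerivAt

/-! ### Exponential coordinates on groups and their homogeneous spaces. -/

/-- The map `e` is an exponential map of the topological group `G` with Lie algebra `𝔤`, locally
inverted by `l`. -/
structure IsExpCoord {𝔤 G : Type*} [NormedAddCommGroup 𝔤] [NormedSpace ℝ 𝔤] [Group G]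
    [TopologicalSpace G] (e : 𝔤 → G) (l : G → 𝔤) : Prop where
  continuous : Continuous e
  exp_zero : e 0 = 1
  log_one : l 1 = 0
  continuousAt_log : ContinuousAt l 1
  exp_log : ∀ᶠ g in 𝓝 1, e (l g) = g
  hasStrictFDerivAt : HasStrictFDerivAt (fun p : 𝔤 × 𝔤 => l (e p.1 * e p.2))
    (ContinuousLinearMap.fst ℝ 𝔤 𝔤 + ContinuousLinearMap.snd ℝ 𝔤 𝔤) 0

namespace IsExpCoord

theorem prod {𝔤 𝔥 G H : Type*} [NormedAddCommGroup 𝔤] [NormedSpace ℝ 𝔤] [Group G]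
    [TopologicalSpace G] [NormedAddCommGroup 𝔥] [NormedSpace ℝ 𝔥] [Group H]
    [TopologicalSpace H] {e : 𝔤 → G} {l : G → 𝔤} {e' : 𝔥 → H} {l' : H → 𝔥}
    (h : IsExpCoord e l) (h' : IsExpCoord e' l') :
    IsExpCoord (Prod.map e e') (Prod.map l l') where
  continuous := h.continuous.prodMap h'.continuous
  exp_zero := Prod.ext h.exp_zero h'.exp_zero
  log_one := Prod.ext h.log_one h'.log_one
  continuousAt_log := h.continuousAt_log.prodMap h'.continuousAt_log
  exp_log := by
    change ∀ᶠ g in 𝓝 ((1 : G), (1 : H)), _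
    filter_upwards [h.exp_log.prod_nhds h'.exp_log] with g hg
    exact Prod.ext hg.1 hg.2
  hasStrictFDerivAt := by
    let A := (ContinuousLinearMap.fst ℝ 𝔤 𝔥).prodMap (ContinuousLinearMap.fst ℝ 𝔤 𝔥)
    let B := (ContinuousLinearMap.snd ℝ 𝔤 𝔥).prodMap (ContinuousLinearMap.snd ℝ 𝔤 𝔥)
    have k₁ := HasStrictFDerivAt.comp (0 : (𝔤 × 𝔥) × (𝔤 × 𝔥)) (f := A)
      h.hasStrictFDerivAt A.hasStrictFDerivAt
    have k₂ := HasStrictFDerivAt.comp (0 : (𝔤 × 𝔥) × (𝔤 × 𝔥)) (f := B)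
      h'.hasStrictFDerivAt B.hasStrictFDerivAt
    exact k₁.prodMk k₂

variable {𝔤 G X V E : Type*} [NormedAddCommGroup 𝔤] [NormedSpace ℝ 𝔤] [FiniteDimensional ℝ 𝔤]
  [Group G] [TopologicalSpace G] [IsTopologicalGroup G] [CompactSpace G]
  [TopologicalSpace X] [T2Space X] [MulAction G X] [ContinuousSMul G X]
  [MulAction.IsPretransitive G X]
  [NormedAddCommGroup V] [NormedSpace ℝ V] [FiniteDimensional ℝ V]
  [NormedAddCommGroup E] [NormedSpace ℝ E] [FiniteDimensional ℝ E] {e : 𝔤 → G} {l : G → 𝔤}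

/-- The orbit map of a homogeneous space, restricted to a complement of the Lie algebra of the
isotropy group, is open at the origin. -/
theorem image_mem_nhds (h : IsExpCoord e l) (x₀ : X) {K : Submodule ℝ 𝔤}
    (hK : ∀ b ∈ K, e b • x₀ = x₀) (j : V →L[ℝ] 𝔤)
    (hc : LinearMap.range (j : V →ₗ[ℝ] 𝔤) ⊔ K = ⊤) {U : Set V} (hU : U ∈ 𝓝 0) :
    (fun v => e (j v) • x₀) '' U ∈ 𝓝 x₀ := by
  have : CompactSpace X := by
    rw [← isCompact_univ_iff, ← (MulAction.surjective_smul G x₀).range_eq]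
    exact isCompact_range (by fun_prop)
  let A : V × K →L[ℝ] 𝔤 × 𝔤 := j.prodMap K.subtypeL
  -- The product of exponentials of the complement and of the isotropy algebra, read in logarithmic
  -- coordinates. Its derivative at 0 is `(v, b) ↦ j v + b`, which is onto by `hc`, so `μ` is open
  -- at 0.
  let μ : V × K → 𝔤 := fun p => l (e (j p.1) * e p.2)
  have hμ0 : μ 0 = 0 := by simp [μ, h.exp_zero, h.log_one]
  have hμ : HasStrictFDerivAt μ
      ((ContinuousLinearMap.fst ℝ 𝔤 𝔤 + ContinuousLinearMap.snd ℝ 𝔤 𝔤).comp A) 0 := by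
    have key := h.hasStrictFDerivAt
    rw [← map_zero A] at key
    exact key.comp (0 : V × K) A.hasStrictFDerivAt
  have hsurj : ((ContinuousLinearMap.fst ℝ 𝔤 𝔤 + ContinuousLinearMap.snd ℝ 𝔤 𝔤).comp A).range
      = ⊤ := by
    rw [eq_top_iff]
    intro y _
    obtain ⟨_, ⟨v, rfl⟩, b, hb, rfl⟩ := Submodule.mem_sup.1 (hc ▸ Submodule.mem_top : y ∈ _ ⊔ K)
    exact ⟨(v, ⟨b, hb⟩), rfl⟩
  have hmap := hμ.map_nhds_eq_of_surj hsurj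
  rw [hμ0] at hmap
  have hmul : Tendsto (fun p : V × K => e (j p.1) * e p.2) (𝓝 0) (𝓝 1) := by
    have hcont : Continuous fun p : V × K => e (j p.1) * e p.2 :=
      (h.continuous.comp (by fun_prop)).mul (h.continuous.comp (by fun_prop))
    convert hcont.tendsto 0
    simp [h.exp_zero]
  have hN : {p : V × K | p.1 ∈ U ∧ e (μ p) = e (j p.1) * e p.2} ∈ 𝓝 0 :=
    inter_mem (continuous_fst.tendsto' (0 : V × K) 0 rfl hU) (hmul.eventually h.exp_log)
  have hlog : Tendsto l (𝓝 1) (𝓝 0) := by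
    simpa only [h.log_one] using h.continuousAt_log.tendsto
  -- Every `g` near 1 is `e (j v) * e b` with `v ∈ U` and `b ∈ K`; as `e b` fixes `x₀`, only the
  -- first factor moves it.
  have hG : {g : G | g • x₀ ∈ (fun v => e (j v) • x₀) '' U} ∈ 𝓝 1 := by
    filter_upwards [hlog (hmap ▸ image_mem_map hN), h.exp_log] with g hg hg'
    obtain ⟨p, ⟨hp, hp'⟩, hpg⟩ := hg
    refine ⟨p.1, hp, ?_⟩
    rw [← hg', ← hpg, hp', mul_smul, hK _ p.2.2]
  -- The open mapping theorem for transitive actions of σ-compact groups turns a neighbourhood of 1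
  -- in `G` into one of `x₀` in `X`.
  refine mem_of_superset (smul_singleton_mem_nhds_of_sigmaCompact hG x₀) ?_
  rw [smul_singleton]
  rintro _ ⟨g, hg, rfl⟩
  exact hg

/-- Around the base point `x₀` of a homogeneous space embedded in a vector space, the exponential
map restricted to a complement of the Lie algebra of the isotropy group is a local
parametrization, and the space is a submanifold there. -/
theorem exists_isSliceChart (h : IsExpCoord e l) {ι : X → E} (hι : Continuous ι) (x₀ : X)
    {D : 𝔤 →L[ℝ] E} (hsmooth : ContDiff ℝ ∞ fun a => ι (e a • x₀))
    (hD : HasFDerivAt (fun a => ι (e a • x₀)) D 0)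
    (hstab : ∀ b, D b = 0 → e b • x₀ = x₀) (j : V →L[ℝ] 𝔤) (hj : Function.Injective j)
    (hc : IsCompl (LinearMap.range (j : V →ₗ[ℝ] 𝔤)) (LinearMap.ker (D : 𝔤 →ₗ[ℝ] E))) :
    ∃ κ : OpenPartialHomeomorph V X, 0 ∈ κ.source ∧ (∀ v, κ v = e (j v) • x₀) ∧
      ∃ (F : Submodule ℝ E) (L : (V × F) ≃L[ℝ] E) (Φ : OpenPartialHomeomorph E E),
        IsSliceChart ι κ L Φ := by
  have hinj : Function.Injective ((D : 𝔤 →ₗ[ℝ] E) ∘ₗ (j : V →ₗ[ℝ] 𝔤)) := by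
    rw [← LinearMap.ker_eq_bot, LinearMap.ker_eq_bot']
    intro v hv
    have : j v ∈ LinearMap.range (j : V →ₗ[ℝ] 𝔤) ⊓ LinearMap.ker (D : 𝔤 →ₗ[ℝ] E) :=
      ⟨⟨v, rfl⟩, hv⟩
    rw [hc.inf_eq_bot, Submodule.mem_bot] at this
    exact hj (this.trans (map_zero j).symm)
  obtain ⟨F, hF⟩ := Submodule.exists_isCompl
    (LinearMap.range ((D : 𝔤 →ₗ[ℝ] E) ∘ₗ (j : V →ₗ[ℝ] 𝔤)))
  let L : (V × F) ≃L[ℝ] E := (((LinearEquiv.ofInjective _ hinj).prodCongr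
    (LinearEquiv.refl ℝ F)).trans (Submodule.prodEquivOfIsCompl _ F hF)).toContinuousLinearEquiv
  have hL : ∀ p, L p = D (j p.1) + p.2 := fun p => rfl
  -- In the decomposition of `E` into the image of `D ∘ j` and a complement `F`, this bends the
  -- first summand onto the orbit and translates along `F`. Its derivative at 0 is the identity, so
  -- its local inverse flattens the orbit.
  let Ψ : E → E := fun w => ι (e (j (L.symm w).1) • x₀) + (L.symm w).2
  let J : E →L[ℝ] 𝔤 := j.comp ((ContinuousLinearMap.fst ℝ V F).comp (L.symm : E →L[ℝ] V × F))
  let R : E →L[ℝ] E := F.subtypeL.comp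
    ((ContinuousLinearMap.snd ℝ V F).comp (L.symm : E →L[ℝ] V × F))
  have hΨ : ContDiff ℝ ∞ Ψ := (hsmooth.comp J.contDiff).add R.contDiff
  have hΨ' : HasFDerivAt Ψ ((ContinuousLinearEquiv.refl ℝ E : E ≃L[ℝ] E) : E →L[ℝ] E) 0 := by
    have hJ : HasFDerivAt (fun w => ι (e (J w) • x₀)) (D.comp J) 0 := by
      rw [← map_zero J] at hD
      exact hD.comp (0 : E) J.hasFDerivAt
    convert! hJ.add R.hasFDerivAt using 1
    ext w
    exact (L.apply_symm_apply w).symm.trans (hL _)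
  obtain ⟨P, hPΨ, hP0, hP⟩ := hΨ.exists_openPartialHomeomorph hΨ'
  let k : V → X := fun v => e (j v) • x₀
  have hk : Continuous k := (h.continuous.comp j.continuous).smul continuous_const
  have hPk : ∀ v, P (L (v, 0)) = ι (k v) := by
    intro v
    simp [hPΨ, Ψ, k]
  let U : Set V := {v | L (v, 0) ∈ P.source}
  have hUo : IsOpen U := P.open_source.preimage (by fun_prop)
  have hU0 : (0 : V) ∈ U := by
    change L (0, 0) ∈ P.source
    rwa [← Prod.zero_eq_mk, map_zero]
  -- The image of `U` is only known to be a neighbourhood of `x₀`, so the chart domain is cut down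
  -- to its interior.
  let O : Set X := interior (k '' U)
  have hO : k 0 ∈ O := by
    have := h.image_mem_nhds x₀ (K := LinearMap.ker (D : 𝔤 →ₗ[ℝ] E)) (fun b hb => hstab b hb) j
      hc.sup_eq_top (hUo.mem_nhds hU0)
    have hk0 : k 0 = x₀ := by simp [k, h.exp_zero]
    rw [hk0]
    exact mem_interior_iff_mem_nhds.2 this
  have hleft : ∀ v ∈ U, P.symm (ι (k v)) = L (v, 0) := fun v hv => by
    rw [← hPk, P.left_inv hv]
  have htarget : ∀ v ∈ U, ι (k v) ∈ P.target := fun v hv => hPk v ▸ P.map_source hv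
  have hOsub : ∀ x ∈ O, ∃ v ∈ U, k v = x := fun x hx =>
    (interior_subset : O ⊆ k '' U) hx
  have hr : ∀ v ∈ U, (L.symm (P.symm (ι (k v)))).1 = v := fun v hv => by simp [hleft v hv]
  let κ : OpenPartialHomeomorph V X :=
    { toFun := k
      invFun := fun x => (L.symm (P.symm (ι x))).1
      source := U ∩ k ⁻¹' O
      target := O
      map_source' := fun v hv => hv.2
      map_target' := by
        intro x hx
        obtain ⟨v, hv, rfl⟩ := hOsub x hx
        rw [hr v hv]
        exact ⟨hv, hx⟩
      left_inv' := fun v hv => hr v hv.1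
      right_inv' := by
        intro x hx
        obtain ⟨v, hv, rfl⟩ := hOsub x hx
        rw [hr v hv]
      open_source := hUo.inter (isOpen_interior.preimage hk)
      open_target := isOpen_interior
      continuousOn_toFun := hk.continuousOn
      continuousOn_invFun := by
        refine continuous_fst.comp_continuousOn (L.symm.continuous.comp_continuousOn
          (P.continuousOn_symm.comp hι.continuousOn ?_))
        intro x hx
        obtain ⟨v, hv, rfl⟩ := hOsub x hx
        exact htarget v hv }
  refine ⟨κ, ⟨hU0, hO⟩, fun v => rfl, F, L, P.symm, hP, ?_, ?_, ?_⟩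
  · rw [P.symm_symm, hPΨ]
    exact hΨ.contDiffOn
  · intro x hx
    obtain ⟨v, hv, rfl⟩ := hOsub x hx
    exact htarget v hv
  · intro x hx
    obtain ⟨v, hv, rfl⟩ := hOsub x hx
    change P.symm (ι (k v)) = L ((L.symm (P.symm (ι (k v)))).1, 0)
    rw [hr v hv, hleft v hv]

end IsExpCoord

/-! ### The special unitary group -/

/-- The Lie algebra of `SU(k)`: traceless skew-Hermitian matrices. -/
def suAlgebra (k : ℕ) : Submodule ℝ (Matrix (Fin k) (Fin k) ℂ) where
  carrier := {A | Aᴴ = -A ∧ A.trace = 0}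
  add_mem' := by
    rintro A B ⟨hA, hA'⟩ ⟨hB, hB'⟩
    exact ⟨by rw [conjTranspose_add, hA, hB, neg_add], by rw [trace_add, hA', hB', add_zero]⟩
  zero_mem' := ⟨by simp, by simp⟩
  smul_mem' := by
    rintro c A ⟨hA, hA'⟩
    exact ⟨by rw [conjTranspose_smul, hA, smul_neg, star_trivial],
      by rw [trace_smul, hA', smul_zero]⟩

/-- Over the reals, `M_k(ℂ) = su(k) ⊕ i su(k) ⊕ ℂ·1`, by splitting off the trace and then the
skew-Hermitian part. Counting dimensions gives `2k² = 2 dim su(k) + 2`. -/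
theorem finrank_suAlgebra {k : ℕ} (hk : 1 ≤ k) : Module.finrank ℝ (suAlgebra k) = k ^ 2 - 1 := by
  have hk' : (k : ℂ) ≠ 0 := by exact_mod_cast (by omega : k ≠ 0)
  let f : (suAlgebra k × suAlgebra k) × ℂ →ₗ[ℝ] Matrix (Fin k) (Fin k) ℂ :=
    { toFun := fun p => p.1.1.1 + Complex.I • p.1.2.1 + p.2 • 1
      map_add' := fun p q => by
        simp only [Prod.fst_add, Prod.snd_add, Submodule.coe_add, smul_add, add_smul]
        abel
      map_smul' := fun c p => by
        simp only [Prod.smul_fst, Prod.smul_snd, Submodule.coe_smul, RingHom.id_apply, smul_add,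
          smul_comm Complex.I c, smul_assoc] }
  have hf : ∀ p, f p = p.1.1.1 + Complex.I • p.1.2.1 + p.2 • 1 := fun p => rfl
  have hinj : Function.Injective f := by
    rw [← LinearMap.ker_eq_bot, LinearMap.ker_eq_bot']
    rintro ⟨⟨⟨a, ha, ha'⟩, ⟨b, hb, hb'⟩⟩, z⟩ h
    rw [hf] at h
    simp only at h
    have hz : z = 0 := by
      have := congrArg trace h
      simpa [trace_add, trace_smul, ha', hb', hk'] using this
    subst hz
    rw [zero_smul, add_zero] at h
    have h' := congrArg conjTranspose h
    rw [conjTranspose_add, conjTranspose_smul, ha, hb, conjTranspose_zero] at h'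
    have h'' : -a + Complex.I • b = 0 := by simpa using h'
    have hb0 : Complex.I • b = 0 := by
      have : (2 : ℂ) • (Complex.I • b) = (a + Complex.I • b) + (-a + Complex.I • b) := by
        rw [two_smul]; abel
      rw [h, h'', add_zero] at this
      exact (smul_eq_zero.1 this).resolve_left two_ne_zero
    have ha0 : a = 0 := by simpa [hb0] using h
    have hb0' : b = 0 := (smul_eq_zero.1 hb0).resolve_left Complex.I_ne_zero
    subst ha0 hb0'
    rfl
  have hsurj : Function.Surjective f := by
    intro A
    let z : ℂ := A.trace / k
    let B := A - z • 1
    have hB : B.trace = 0 := by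
      simp only [B, z, trace_sub, trace_smul, trace_one, Fintype.card_fin, smul_eq_mul]
      rw [div_mul_cancel₀ _ hk', sub_self]
    have hB' : Bᴴ.trace = 0 := by rw [trace_conjTranspose, hB, star_zero]
    refine ⟨((⟨(1 / 2 : ℂ) • (B - Bᴴ), ?_, ?_⟩, ⟨(-Complex.I / 2) • (B + Bᴴ), ?_, ?_⟩), z), ?_⟩
    · rw [conjTranspose_smul, conjTranspose_sub, conjTranspose_conjTranspose, ← smul_neg, neg_sub]
      simp
    · rw [trace_smul, trace_sub, hB, hB', sub_zero, smul_zero]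
    · rw [conjTranspose_smul, conjTranspose_add, conjTranspose_conjTranspose, ← neg_smul, add_comm]
      simp [neg_div]
    · rw [trace_smul, trace_add, hB, hB', add_zero, smul_zero]
    · rw [hf]
      have : Complex.I * (-Complex.I / 2) = 1 / 2 := by
        rw [← mul_div_assoc, mul_neg, Complex.I_mul_I, neg_neg]
      simp only [smul_smul, this]
      have : (1 / 2 : ℂ) • (B - Bᴴ) + (1 / 2 : ℂ) • (B + Bᴴ) = B := by
        rw [← smul_add, sub_add_add_cancel, ← two_smul ℂ B, smul_smul]
        norm_num
      rw [this]
      simp [B]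
  have e := (LinearEquiv.ofBijective f ⟨hinj, hsurj⟩).finrank_eq
  rw [Module.finrank_prod, Module.finrank_prod, Complex.finrank_real_complex,
    finrank_real_of_complex, Module.finrank_matrix] at e
  simp only [Fintype.card_fin, Module.finrank_self, mul_one] at e
  have : k ^ 2 = k * k := sq k
  omega

theorem exp_conjTranspose_mul_exp {ι : Type*} [Fintype ι] [DecidableEq ι] {A : Matrix ι ι ℂ}
    (hA : Aᴴ = -A) : (NormedSpace.exp A)ᴴ * NormedSpace.exp A = 1 := by
  rw [← exp_conjTranspose, hA, ← Matrix.exp_add_of_commute _ _ (Commute.refl A).neg_left,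
    neg_add_cancel, NormedSpace.exp_zero]

/-- `i A` is Hermitian, so `A` is unitarily diagonalizable, and for diagonal matrices this is the
exponential of a sum. -/
theorem det_exp_of_conjTranspose_eq_neg {ι : Type*} [Fintype ι] [DecidableEq ι] {A : Matrix ι ι ℂ}
    (hA : Aᴴ = -A) : (NormedSpace.exp A).det = Complex.exp A.trace := by
  have hH : (Complex.I • A).IsHermitian := by
    change (Complex.I • A)ᴴ = _
    rw [conjTranspose_smul, hA]
    simp
  obtain ⟨U, v, hU⟩ : ∃ (U : unitaryGroup ι ℂ) (v : ι → ℂ),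
      A = (U : Matrix ι ι ℂ) * diagonal v * (U : Matrix ι ι ℂ)⁻¹ := by
    refine ⟨hH.eigenvectorUnitary, fun i => -Complex.I * hH.eigenvalues i, ?_⟩
    have h := hH.spectral_theorem
    rw [Unitary.conjStarAlgAut_apply] at h
    have hinv : (hH.eigenvectorUnitary : Matrix ι ι ℂ)⁻¹ =
        star (hH.eigenvectorUnitary : Matrix ι ι ℂ) :=
      inv_eq_left_inv (Unitary.coe_star_mul_self _)
    have hd : diagonal (fun i => -Complex.I * (hH.eigenvalues i : ℂ)) =
        (-Complex.I) • diagonal (RCLike.ofReal ∘ hH.eigenvalues : ι → ℂ) := by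
      rw [← diagonal_smul]; rfl
    rw [hinv, hd, mul_smul_comm, smul_mul_assoc, ← h, smul_smul]
    simp
  have hUu : IsUnit (U : Matrix ι ι ℂ) := (Unitary.toUnits U).isUnit
  have hUd : IsUnit (U : Matrix ι ι ℂ).det := (isUnit_iff_isUnit_det _).1 hUu
  rw [hU, Matrix.exp_conj _ _ hUu, det_conj hUu, Matrix.exp_diagonal, det_diagonal,
    trace_mul_comm, ← mul_assoc, nonsing_inv_mul _ hUd, one_mul, trace_diagonal, Complex.exp_sum]
  refine Finset.prod_congr rfl fun i _ => ?_
  rw [Pi.coe_exp, Complex.exp_eq_exp_ℂ]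

instance (k : ℕ) : IsTopologicalGroup (SU k) where
  continuous_mul := continuous_mul
  continuous_inv := by
    refine Continuous.subtype_mk ?_ _
    exact continuous_subtype_val.star

instance (k : ℕ) : CompactSpace (SU k) := by
  suffices h : IsCompact (specialUnitaryGroup (Fin k) ℂ : Set (Matrix (Fin k) (Fin k) ℂ)) from
    isCompact_iff_compactSpace.1 h
  have hK : IsCompact {A : Matrix (Fin k) (Fin k) ℂ | ∀ i j, A i j ∈ Metric.closedBall 0 1} := by
    have := isCompact_univ_pi fun _ : Fin k =>
      isCompact_univ_pi fun _ : Fin k => isCompact_closedBall (0 : ℂ) 1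
    convert! this using 1
    ext A
    exact ⟨fun h i _ j _ => h i j, fun h i j => h i trivial j trivial⟩
  refine hK.of_isClosed_subset ?_ ?_
  · have : (specialUnitaryGroup (Fin k) ℂ : Set (Matrix (Fin k) (Fin k) ℂ)) =
        {A | A * star A = 1} ∩ {A | A.det = 1} := by
      ext A
      exact mem_specialUnitaryGroup_iff.trans (and_congr_left' mem_unitaryGroup_iff)
    rw [this]
    refine (isClosed_eq ?_ continuous_const).inter (isClosed_eq ?_ continuous_const)
    · fun_prop
    · exact continuous_id.matrix_det
  · intro A hA i j
    simpa using entry_norm_bound_of_unitary (specialUnitaryGroup_le_unitaryGroup hA) i j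

namespace suAlgebra

variable {k : ℕ}

/-- The exponential map of `SU(k)`. -/
noncomputable def exp (a : suAlgebra k) : SU k :=
  ⟨NormedSpace.exp (a : Matrix (Fin k) (Fin k) ℂ), by
    refine mem_specialUnitaryGroup_iff.2
      ⟨mem_unitaryGroup_iff'.2 (exp_conjTranspose_mul_exp a.2.1), ?_⟩
    rw [det_exp_of_conjTranspose_eq_neg a.2.1, a.2.2, Complex.exp_zero]⟩

theorem coe_exp (a : suAlgebra k) :
    (exp a : Matrix (Fin k) (Fin k) ℂ) = NormedSpace.exp (a : Matrix (Fin k) (Fin k) ℂ) := rfl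

end suAlgebra

theorem Matrix.hasStrictFDerivAt_exp_zero (k : ℕ) :
    HasStrictFDerivAt (NormedSpace.exp : Matrix (Fin k) (Fin k) ℂ → Matrix (Fin k) (Fin k) ℂ)
      (ContinuousLinearMap.id ℝ _) 0 :=
  _root_.hasStrictFDerivAt_exp_zero

theorem Matrix.contDiff_exp (k : ℕ) :
    ContDiff ℝ ∞ (NormedSpace.exp : Matrix (Fin k) (Fin k) ℂ → Matrix (Fin k) (Fin k) ℂ) :=
  contDiff_iff_contDiffAt.2 fun x => (NormedSpace.exp_analytic (𝕂 := ℝ) x).contDiffAt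

theorem Matrix.exists_log (k : ℕ) : ∃ ℓ : Matrix (Fin k) (Fin k) ℂ → Matrix (Fin k) (Fin k) ℂ,
    HasStrictFDerivAt ℓ (ContinuousLinearMap.id ℝ _) 1 ∧ ℓ 1 = 0 ∧
    (∀ᶠ x in 𝓝 0, ℓ (NormedSpace.exp x) = x) ∧ ∀ᶠ y in 𝓝 1, NormedSpace.exp (ℓ y) = y := by
  have h : HasStrictFDerivAt
      (NormedSpace.exp : Matrix (Fin k) (Fin k) ℂ → Matrix (Fin k) (Fin k) ℂ)
      ((ContinuousLinearEquiv.refl ℝ (Matrix (Fin k) (Fin k) ℂ) :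
        Matrix (Fin k) (Fin k) ℂ ≃L[ℝ] Matrix (Fin k) (Fin k) ℂ) :
        Matrix (Fin k) (Fin k) ℂ →L[ℝ] Matrix (Fin k) (Fin k) ℂ) 0 :=
    Matrix.hasStrictFDerivAt_exp_zero k
  have h1 : NormedSpace.exp (0 : Matrix (Fin k) (Fin k) ℂ) = 1 := NormedSpace.exp_zero
  refine ⟨h.localInverse, ?_, ?_, h.eventually_left_inverse, ?_⟩
  · have := h.to_localInverse
    rw [h1] at this
    exact this
  · have := h.localInverse_apply_image
    rwa [h1] at this
  · have := h.eventually_right_inverse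
    rw [h1] at this
    exact this

namespace suAlgebra

variable {k : ℕ}

/-- A logarithm of a special unitary matrix close to the identity lies in the Lie algebra. -/
theorem eventually_log_mem {ℓ : Matrix (Fin k) (Fin k) ℂ → Matrix (Fin k) (Fin k) ℂ}
    (hc : ContinuousAt ℓ 1) (h1 : ℓ 1 = 0)
    (hl : ∀ᶠ x in 𝓝 0, ℓ (NormedSpace.exp x) = x)
    (hr : ∀ᶠ y in 𝓝 1, NormedSpace.exp (ℓ y) = y) :
    ∀ᶠ g : SU k in 𝓝 1, ℓ g ∈ suAlgebra k ∧
      NormedSpace.exp (ℓ g) = (g : Matrix (Fin k) (Fin k) ℂ) := by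
  have hval : Tendsto (fun g : SU k => (g : Matrix (Fin k) (Fin k) ℂ)) (𝓝 1) (𝓝 1) :=
    continuous_subtype_val.tendsto' _ _ rfl
  have hlog : Tendsto (fun g : SU k => ℓ g) (𝓝 1) (𝓝 0) := by
    rw [← h1]
    exact hc.tendsto.comp hval
  have hneg : Tendsto (fun g : SU k => -(ℓ g)ᴴ) (𝓝 1) (𝓝 0) := by
    have : Continuous fun A : Matrix (Fin k) (Fin k) ℂ => -Aᴴ := by fun_prop
    exact (this.tendsto' 0 0 (by simp)).comp hlog
  -- `det g = 1` only gives `exp (tr (ℓ g)) = 1`. Near 1 the trace stays in the strip `|Im| < π`,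
  -- where the principal logarithm recovers it, so it is 0.
  have htr : Tendsto (fun g : SU k => ((ℓ g).trace).im) (𝓝 1) (𝓝 0) := by
    have : Continuous fun A : Matrix (Fin k) (Fin k) ℂ => A.trace.im :=
      Complex.continuous_im.comp (continuous_id.matrix_trace)
    exact (this.tendsto' 0 0 (by simp)).comp hlog
  filter_upwards [hval.eventually hr, hneg.eventually hl,
    htr.eventually (Ioo_mem_nhds (neg_lt_zero.2 Real.pi_pos) Real.pi_pos)] with g hg hg' hg''
  -- Unitarity makes `-(ℓ g)ᴴ` a second logarithm of `g`; both are near 0, where `ℓ` inverts the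
  -- exponential, so they agree.
  have hskew : (ℓ g)ᴴ = -ℓ g := by
    have hgi : (g : Matrix (Fin k) (Fin k) ℂ)ᴴ⁻¹ = g :=
      inv_eq_left_inv (mem_unitaryGroup_iff.1 (specialUnitaryGroup_le_unitaryGroup g.2))
    have hl1 : ℓ (NormedSpace.exp (-(ℓ g)ᴴ)) = ℓ g := by
      rw [Matrix.exp_neg, Matrix.exp_conjTranspose, hg, hgi]
    rw [hl1] at hg'
    exact neg_eq_iff_eq_neg.1 hg'.symm
  refine ⟨⟨hskew, ?_⟩, hg⟩
  have hdet := det_exp_of_conjTranspose_eq_neg hskew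
  rw [hg, (mem_specialUnitaryGroup_iff.1 g.2).2] at hdet
  rw [← Complex.log_exp hg''.1 hg''.2.le, ← hdet, Complex.log_one]

theorem continuous_exp : Continuous (exp : suAlgebra k → SU k) :=
  Continuous.subtype_mk ((Matrix.contDiff_exp k).continuous.comp continuous_subtype_val) _

theorem exp_zero : exp (0 : suAlgebra k) = 1 := Subtype.ext NormedSpace.exp_zero

/-- The matrix logarithm lies in `su(k)` only near 1. A linear projection onto `su(k)` extends it to
a map on all of `SU(k)` without changing it there. -/
theorem exists_isExpCoord (k : ℕ) : ∃ l : SU k → suAlgebra k, IsExpCoord exp l := by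
  obtain ⟨ℓ, hd, h1, hl, hr⟩ := Matrix.exists_log k
  obtain ⟨π, hπ⟩ := LinearMap.exists_leftInverse_of_injective (suAlgebra k).subtype
    (Submodule.ker_subtype _)
  let P : Matrix (Fin k) (Fin k) ℂ →L[ℝ] suAlgebra k := LinearMap.toContinuousLinearMap π
  have hP : ∀ a : suAlgebra k, P a = a := fun a => LinearMap.congr_fun hπ a
  have hPd : HasStrictFDerivAt (fun A => P (ℓ A)) P 1 := P.hasStrictFDerivAt.comp 1 hd
  refine ⟨fun g => P (ℓ g), continuous_exp, exp_zero, ?_, ?_, ?_, ?_⟩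
  · simp [h1]
  · exact ContinuousAt.comp (x := (1 : SU k)) (f := fun g : SU k => (g : Matrix (Fin k) (Fin k) ℂ))
      (g := fun A => P (ℓ A)) hPd.continuousAt continuous_subtype_val.continuousAt
  · filter_upwards [eventually_log_mem hd.continuousAt h1 hl hr] with g hg
    refine Subtype.ext ?_
    rw [coe_exp, hP ⟨ℓ g, hg.1⟩]
    exact hg.2
  · let A₁ : suAlgebra k × suAlgebra k →L[ℝ] Matrix (Fin k) (Fin k) ℂ :=
      (suAlgebra k).subtypeL.comp (ContinuousLinearMap.fst ℝ _ _)
    let A₂ : suAlgebra k × suAlgebra k →L[ℝ] Matrix (Fin k) (Fin k) ℂ :=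
      (suAlgebra k).subtypeL.comp (ContinuousLinearMap.snd ℝ _ _)
    have e₁ : HasStrictFDerivAt (fun p => NormedSpace.exp (A₁ p)) A₁ 0 := by
      have := Matrix.hasStrictFDerivAt_exp_zero k
      rw [← map_zero A₁] at this
      exact this.comp 0 A₁.hasStrictFDerivAt
    have e₂ : HasStrictFDerivAt (fun p => NormedSpace.exp (A₂ p)) A₂ 0 := by
      have := Matrix.hasStrictFDerivAt_exp_zero k
      rw [← map_zero A₂] at this
      exact this.comp 0 A₂.hasStrictFDerivAt
    have e := e₁.mul' e₂
    have h0 : NormedSpace.exp (A₁ 0) * NormedSpace.exp (A₂ 0) = 1 := by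
      simp [NormedSpace.exp_zero]
    rw [← h0] at hPd
    refine (hPd.comp (0 : suAlgebra k × suAlgebra k) e).congr_fderiv ?_
    refine ContinuousLinearMap.ext fun p => ?_
    change P (NormedSpace.exp (A₁ 0) * A₂ p + A₁ p * NormedSpace.exp (A₂ 0)) = p.1 + p.2
    rw [map_zero, map_zero, NormedSpace.exp_zero, one_mul, mul_one, map_add, add_comm]
    exact congrArg₂ _ (hP _) (hP _)

end suAlgebra

/-! ### Orbits of compact groups -/

/-- A homogeneous space of a compact group, equivariantly and injectively mapped to a vector space,
is an embedded submanifold, with the translates of exponential coordinates as an atlas. -/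
theorem IsExpCoord.exists_isSubmanifoldAtlas {𝔤 G X E : Type*} [NormedAddCommGroup 𝔤]
    [NormedSpace ℝ 𝔤] [FiniteDimensional ℝ 𝔤] [Group G] [TopologicalSpace G]
    [IsTopologicalGroup G] [CompactSpace G] [TopologicalSpace X] [MulAction G X]
    [ContinuousSMul G X] [MulAction.IsPretransitive G X] [NormedAddCommGroup E] [NormedSpace ℝ E]
    [FiniteDimensional ℝ E] {e : 𝔤 → G} {l : G → 𝔤} (h : IsExpCoord e l) {ι : X → E}
    (hι : Continuous ι) (hι' : Function.Injective ι) (T : G → E →ₗ[ℝ] E)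
    (hT : ∀ g x, ι (g • x) = T g (ι x)) (hT' : ∀ g w, T g⁻¹ (T g w) = w) (x₀ : X)
    {D : 𝔤 →L[ℝ] E} (hsmooth : ContDiff ℝ ∞ fun a => ι (e a • x₀))
    (hD : HasFDerivAt (fun a => ι (e a • x₀)) D 0)
    (hstab : ∀ b, D b = 0 → e b • x₀ = x₀) {d : ℕ} (j : EuclideanSpace ℝ (Fin d) →L[ℝ] 𝔤)
    (hj : Function.Injective j)
    (hc : IsCompl (LinearMap.range (j : EuclideanSpace ℝ (Fin d) →ₗ[ℝ] 𝔤))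
      (LinearMap.ker (D : 𝔤 →ₗ[ℝ] E))) :
    ∃ (κ : OpenPartialHomeomorph (EuclideanSpace ℝ (Fin d)) X) (h₀ : 0 ∈ κ.source),
      (∀ v, κ v = e (j v) • x₀) ∧
        IsSubmanifoldAtlas ι (homogeneousChartedSpace (G := G) κ h₀) := by
  have : CompactSpace X := by
    rw [← isCompact_univ_iff, ← (MulAction.surjective_smul G x₀).range_eq]
    exact isCompact_range (by fun_prop)
  have : T2Space X := T2Space.of_injective_continuous hι' hι
  obtain ⟨κ, h₀, hκ, F, L, Φ, hs⟩ := h.exists_isSliceChart hι x₀ hsmooth hD hstab j hj hc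
  refine ⟨κ, h₀, hκ, hs.isSubmanifoldAtlas_of_equiv (fun g => (LinearEquiv.ofLinearMap (T g) (T g⁻¹)
    (LinearMap.ext fun w => ?_) (LinearMap.ext fun w => ?_)).toContinuousLinearEquiv)
    hT h₀ (hι.isClosedEmbedding hι').isEmbedding⟩
  · simpa using hT' g⁻¹ w
  · exact hT' g w

/-! ### Smoothness and derivative of conjugation `a ↦ F a * W * (F a)ᴴ`. -/

section Conj

variable {𝔤 ι : Type*} [NormedAddCommGroup 𝔤] [NormedSpace ℝ 𝔤] [Fintype ι] [DecidableEq ι]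

/-- Conjugate transposition as a real linear map. -/
def Matrix.conjTransposeReal (ι : Type*) : Matrix ι ι ℂ →ₗ[ℝ] Matrix ι ι ℂ where
  toFun A := Aᴴ
  map_add' := conjTranspose_add
  map_smul' c A := by simp [conjTranspose_smul]

theorem ContDiff.conj {F : 𝔤 → Matrix ι ι ℂ} (hF : ContDiff ℝ ∞ F) (W : Matrix ι ι ℂ) :
    ContDiff ℝ ∞ fun a => F a * W * (F a)ᴴ :=
  (hF.mul contDiff_const).mul
    ((LinearMap.toContinuousLinearMap (conjTransposeReal ι)).contDiff.comp hF)

theorem HasFDerivAt.exists_conj {F : 𝔤 → Matrix ι ι ℂ} {F' : 𝔤 →L[ℝ] Matrix ι ι ℂ}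
    (hF : HasFDerivAt F F' 0) (h0 : F 0 = 1) (W : Matrix ι ι ℂ) :
    ∃ D : 𝔤 →L[ℝ] Matrix ι ι ℂ, (∀ a, D a = F' a * W + W * (F' a)ᴴ) ∧
      HasFDerivAt (fun a => F a * W * (F a)ᴴ) D 0 := by
  have h := (hF.mul' (hasFDerivAt_const W 0)).mul'
    ((LinearMap.toContinuousLinearMap (conjTransposeReal ι)).hasFDerivAt.comp 0 hF)
  refine ⟨_, fun a => ?_, h⟩
  change F 0 * W * (F' a)ᴴ + (F 0 * 0 + F' a * W) * (F 0)ᴴ = _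
  rw [h0, conjTranspose_one, mul_one, mul_zero, zero_add, one_mul, add_comm]

end Conj

/-! ### Matrices commuting with the special unitary group -/

theorem exists_smul_mem_specialUnitaryGroup {k : ℕ} {U : Matrix (Fin k) (Fin k) ℂ}
    (hU : U ∈ unitaryGroup (Fin k) ℂ) :
    ∃ z : ℂ, z * star z = 1 ∧ z • U ∈ specialUnitaryGroup (Fin k) ℂ := by
  rcases Nat.eq_zero_or_pos k with rfl | hk
  · exact ⟨1, by simp, mem_specialUnitaryGroup_iff.2 ⟨by simpa using hU, by simp⟩⟩
  · have hk' : (k : ℂ) ≠ 0 := by exact_mod_cast hk.ne'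
    have hd : ‖U.det‖ = 1 := CStarRing.norm_of_mem_unitary (det_of_mem_unitary hU)
    -- A `k`-th root of `1 / det U`, since `det U` has modulus one.
    let z : ℂ := Complex.exp ((-(U.det.arg / k) : ℝ) * Complex.I)
    have hz : z * star z = 1 := by
      rw [Complex.star_def, Complex.mul_conj, Complex.normSq_eq_norm_sq,
        Complex.norm_exp_ofReal_mul_I]
      simp
    refine ⟨z, hz, mem_specialUnitaryGroup_iff.2 ⟨mem_unitaryGroup_iff.2 ?_, ?_⟩⟩
    · rw [star_smul, smul_mul_smul_comm, mem_unitaryGroup_iff.1 hU, hz, one_smul]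
    · have h := Complex.norm_mul_exp_arg_mul_I U.det
      rw [hd, Complex.ofReal_one, one_mul] at h
      rw [det_smul, Fintype.card_fin, ← h, ← Complex.exp_nat_mul, ← Complex.exp_add,
        Complex.exp_eq_one_iff]
      refine ⟨0, ?_⟩
      push_cast
      field_simp
      ring

/-- Under the operator norm the matrices form a C*-algebra, and a C*-algebra is spanned by its
unitaries. -/
theorem span_unitaryGroup_eq_top (k : ℕ) :
    Submodule.span ℂ (unitaryGroup (Fin k) ℂ : Set (Matrix (Fin k) (Fin k) ℂ)) = ⊤ :=
  open scoped Matrix.Norms.L2Operator in CStarAlgebra.span_unitary (Matrix (Fin k) (Fin k) ℂ)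

/-- A matrix which commutes with all special unitary matrices commutes with all matrices. -/
theorem commute_of_commute_specialUnitaryGroup {k : ℕ} {M : Matrix (Fin k) (Fin k) ℂ}
    (hM : ∀ U : SU k, Commute (U : Matrix (Fin k) (Fin k) ℂ) M) (A : Matrix (Fin k) (Fin k) ℂ) :
    Commute A M := by
  have hA : A ∈ Submodule.span ℂ (unitaryGroup (Fin k) ℂ : Set (Matrix (Fin k) (Fin k) ℂ)) := by
    rw [span_unitaryGroup_eq_top]
    trivial
  induction hA using Submodule.span_induction with
  | mem U hU =>
    obtain ⟨z, hz, hzU⟩ := exists_smul_mem_specialUnitaryGroup hU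
    have h := (hM ⟨z • U, hzU⟩).smul_left (star z)
    rwa [smul_smul, mul_comm, hz, one_smul] at h
  | zero => exact Commute.zero_left M
  | add A B _ _ hA hB => exact hA.add_left hB
  | smul c A _ hA => exact hA.smul_left c

theorem SU.mem_center_iff {k : ℕ} {U : SU k} :
    U ∈ Subgroup.center (SU k) ↔ ∀ A, Commute A (U : Matrix (Fin k) (Fin k) ℂ) := by
  rw [Subgroup.mem_center_iff]
  refine ⟨fun h => commute_of_commute_specialUnitaryGroup fun V => congrArg Subtype.val (h V),
    fun h V => Subtype.ext (h V)⟩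

theorem exists_eq_smul_one_of_commute {ι : Type*} [Fintype ι] [DecidableEq ι] {M : Matrix ι ι ℂ}
    (hM : ∀ A, Commute A M) : ∃ c : ℂ, M = c • 1 := by
  obtain ⟨c, hc⟩ := mem_range_scalar_of_commute_single (M := M) fun i j _ => hM _
  exact ⟨c, by rw [← hc, scalar_apply, smul_one_eq_diagonal]⟩

theorem suAlgebra.contDiff_coe_exp (k : ℕ) :
    ContDiff ℝ ∞ fun a : suAlgebra k => NormedSpace.exp (a : Matrix (Fin k) (Fin k) ℂ) :=
  (Matrix.contDiff_exp k).comp (suAlgebra k).subtypeL.contDiff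

theorem suAlgebra.hasFDerivAt_coe_exp (k : ℕ) :
    HasFDerivAt (fun a : suAlgebra k => NormedSpace.exp (a : Matrix (Fin k) (Fin k) ℂ))
      (suAlgebra k).subtypeL 0 := by
  have h := (Matrix.hasStrictFDerivAt_exp_zero k).hasFDerivAt
  rw [← map_zero (suAlgebra k).subtypeL] at h
  exact h.comp 0 (suAlgebra k).subtypeL.hasFDerivAt

/-- A traceless scalar matrix vanishes. -/
theorem suAlgebra.eq_zero_of_commute {k : ℕ} (hk : 1 ≤ k) {a : suAlgebra k}
    (h : ∀ A, Commute A (a : Matrix (Fin k) (Fin k) ℂ)) : a = 0 := by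
  obtain ⟨c, hc⟩ := exists_eq_smul_one_of_commute h
  have htr := a.2.2
  rw [hc, trace_smul, trace_one, Fintype.card_fin, smul_eq_mul] at htr
  have hk' : (k : ℂ) ≠ 0 := by exact_mod_cast (by omega : k ≠ 0)
  refine Subtype.ext ?_
  rw [hc, (mul_eq_zero.1 htr).resolve_right hk', zero_smul]
  rfl

theorem isCompl_range_of_bijective {V W E : Type*} [AddCommGroup V] [Module ℝ V] [AddCommGroup W]
    [Module ℝ W] [AddCommGroup E] [Module ℝ E] {j : V →ₗ[ℝ] W} (hj : Function.Surjective j)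
    {D : W →ₗ[ℝ] E} (hD : ∀ b, D b = 0 → b = 0) :
    IsCompl (LinearMap.range j) (LinearMap.ker D) := by
  rw [LinearMap.range_eq_top.2 hj, LinearMap.ker_eq_bot'.2 hD]
  exact isCompl_top_bot

theorem SU.star_mul_self {k : ℕ} (U : SU k) : (U : Matrix (Fin k) (Fin k) ℂ)ᴴ * U.1 = 1 :=
  mem_unitaryGroup_iff'.1 (specialUnitaryGroup_le_unitaryGroup U.2)

theorem SU.mul_star_self {k : ℕ} (U : SU k) : (U : Matrix (Fin k) (Fin k) ℂ) * U.1ᴴ = 1 :=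
  mem_unitaryGroup_iff.1 (specialUnitaryGroup_le_unitaryGroup U.2)

theorem SU.coe_inv {k : ℕ} (U : SU k) :
    ((U⁻¹ : SU k) : Matrix (Fin k) (Fin k) ℂ) = (U : Matrix (Fin k) (Fin k) ℂ)ᴴ := rfl

/-- `SU(k)` is treated as a homogeneous space of itself under left multiplication; the isotropy
algebra is zero, so `j` ranges over all of `su(k)`. -/
theorem SU.exists_isSubmanifoldAtlas {k : ℕ}
    (j : EuclideanSpace ℝ (Fin (k ^ 2 - 1)) ≃L[ℝ] suAlgebra k) :
    ∃ (κ : OpenPartialHomeomorph (EuclideanSpace ℝ (Fin (k ^ 2 - 1))) (SU k))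
      (h₀ : 0 ∈ κ.source), (∀ v, κ v = suAlgebra.exp (j v)) ∧
        IsSubmanifoldAtlas (suInclusion k) (homogeneousChartedSpace (G := SU k) κ h₀) := by
  obtain ⟨l, hl⟩ := suAlgebra.exists_isExpCoord k
  have key : (fun a : suAlgebra k => suInclusion k (suAlgebra.exp a • (1 : SU k))) =
      fun a : suAlgebra k => NormedSpace.exp (a : Matrix (Fin k) (Fin k) ℂ) := by
    funext a
    rw [smul_eq_mul, mul_one]
    rfl
  have H := hl.exists_isSubmanifoldAtlas (G := SU k) (X := SU k) (ι := suInclusion k)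
    continuous_subtype_val Subtype.val_injective
  obtain ⟨κ, h₀, hκ, h⟩ := H
    (fun g => LinearMap.mulLeft ℝ (g : Matrix (Fin k) (Fin k) ℂ)) (by intro g x; rfl)
    (fun g w => by
      rw [LinearMap.mulLeft_apply, LinearMap.mulLeft_apply, ← mul_assoc, SU.coe_inv,
        SU.star_mul_self, one_mul]) 1
    (key ▸ suAlgebra.contDiff_coe_exp k) (key ▸ suAlgebra.hasFDerivAt_coe_exp k)
    (fun b hb => by
      rw [show b = 0 from Subtype.ext hb, suAlgebra.exp_zero, one_smul])
    (j : EuclideanSpace ℝ (Fin (k ^ 2 - 1)) →L[ℝ] suAlgebra k) j.injective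
    (isCompl_range_of_bijective j.surjective fun b hb => Subtype.ext hb)
  exact ⟨κ, h₀, fun v => by rw [hκ, smul_eq_mul, mul_one]; rfl, h⟩

/-! ### `SU(k) / Z_k` as a manifold, through the adjoint representation. -/

/-- The adjoint representation of `SU(k) / Z_k`, on matrix units. -/
def psuInclusion (k : ℕ) : PSU k → Fin k × Fin k → Matrix (Fin k) (Fin k) ℂ :=
  Quotient.lift (fun U p => U.1 * single p.1 p.2 1 * U.1ᴴ) fun U V hUV => by
    obtain ⟨z, hz, rfl⟩ : ∃ z ∈ Subgroup.center (SU k), V = U * z :=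
      ⟨U⁻¹ * V, QuotientGroup.leftRel_apply.1 hUV, by group⟩
    funext p
    have h := (SU.mem_center_iff.1 hz (single p.1 p.2 1)).eq
    change _ = (U.1 * z.1) * _ * (U.1 * z.1)ᴴ
    rw [conjTranspose_mul, mul_assoc U.1 z.1, ← h, ← mul_assoc, ← mul_assoc, mul_assoc _ z.1,
      SU.mul_star_self, mul_one]

theorem psuInclusion_mk {k : ℕ} (U : SU k) (p : Fin k × Fin k) :
    psuInclusion k (QuotientGroup.mk U) p = U.1 * single p.1 p.2 1 * U.1ᴴ := rfl

theorem continuous_psuInclusion (k : ℕ) : Continuous (psuInclusion k) := by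
  refine Continuous.quotient_lift ?_ _
  refine continuous_pi fun p => ?_
  exact (continuous_subtype_val.mul continuous_const).mul continuous_subtype_val.star

theorem commute_of_commute_single {k : ℕ} {M : Matrix (Fin k) (Fin k) ℂ}
    (h : ∀ i j, Commute (single i j 1) M) (A : Matrix (Fin k) (Fin k) ℂ) : Commute A M := by
  obtain ⟨c, hc⟩ := mem_range_scalar_of_commute_single (M := M) fun i j _ => h i j
  rw [← hc]
  exact (scalar_commute c (Commute.all c) A).symm

/-- If `U` and `V` conjugate all matrix units alike, then `U† V` commutes with them, hence with all
matrices, and is central. This places the quotient in a vector space, where the results on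
homogeneous spaces apply. -/
theorem injective_psuInclusion (k : ℕ) : Function.Injective (psuInclusion k) := by
  intro x y hxy
  induction x using QuotientGroup.induction_on with | _ U
  induction y using QuotientGroup.induction_on with | _ V
  refine QuotientGroup.eq.2 (SU.mem_center_iff.2 (commute_of_commute_single fun i j => ?_))
  have h := congrFun hxy (i, j)
  rw [psuInclusion_mk, psuInclusion_mk] at h
  change single i j 1 * (U.1ᴴ * V.1) = (U.1ᴴ * V.1) * single i j 1
  calc single i j 1 * (U.1ᴴ * V.1)
      = U.1ᴴ * U.1 * single i j 1 * U.1ᴴ * V.1 := by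
        rw [SU.star_mul_self, one_mul, mul_assoc]
    _ = U.1ᴴ * (U.1 * single i j 1 * U.1ᴴ) * V.1 := by simp only [mul_assoc]
    _ = U.1ᴴ * V.1 * single i j 1 * (V.1ᴴ * V.1) := by rw [h]; simp only [mul_assoc]
    _ = _ := by rw [SU.star_mul_self, mul_one]

/-- The derivative at the base point sends `a` to its commutators with the matrix units. If these
all vanish, `a` is scalar and traceless, hence zero, so again all of `su(k)` gives coordinates. -/
theorem PSU.exists_isSubmanifoldAtlas {k : ℕ} (hk : 1 ≤ k)
    (j : EuclideanSpace ℝ (Fin (k ^ 2 - 1)) ≃L[ℝ] suAlgebra k) :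
    ∃ (κ : OpenPartialHomeomorph (EuclideanSpace ℝ (Fin (k ^ 2 - 1))) (PSU k))
      (h₀ : 0 ∈ κ.source), (∀ v, κ v = QuotientGroup.mk (suAlgebra.exp (j v))) ∧
        IsSubmanifoldAtlas (psuInclusion k) (homogeneousChartedSpace (G := SU k) κ h₀) := by
  obtain ⟨l, hl⟩ := suAlgebra.exists_isExpCoord k
  have hsmul : ∀ U V : SU k, U • (QuotientGroup.mk V : PSU k) = QuotientGroup.mk (U * V) :=
    fun U V => rfl
  have key : (fun a : suAlgebra k =>
      psuInclusion k (suAlgebra.exp a • (QuotientGroup.mk (1 : SU k) : PSU k))) =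
      fun (a : suAlgebra k) (p : Fin k × Fin k) =>
        NormedSpace.exp (a : Matrix (Fin k) (Fin k) ℂ) * single p.1 p.2 1 *
          (NormedSpace.exp (a : Matrix (Fin k) (Fin k) ℂ))ᴴ := by
    funext a p
    rw [hsmul, mul_one]
    rfl
  have h1 : NormedSpace.exp ((0 : suAlgebra k) : Matrix (Fin k) (Fin k) ℂ) = 1 :=
    NormedSpace.exp_zero
  choose D hD hD' using fun p : Fin k × Fin k =>
    (suAlgebra.hasFDerivAt_coe_exp k).exists_conj h1 (single p.1 p.2 1)
  have hker : ∀ b, ContinuousLinearMap.pi D b = 0 → b = 0 := by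
    intro b hb
    refine suAlgebra.eq_zero_of_commute hk (commute_of_commute_single fun i j => ?_)
    have := congrFun hb (i, j)
    change D (i, j) b = 0 at this
    rw [hD] at this
    change b.1 * single i j 1 + single i j 1 * b.1ᴴ = 0 at this
    rw [b.2.1, mul_neg, ← sub_eq_add_neg, sub_eq_zero] at this
    exact this.symm
  obtain ⟨κ, h₀, hκ, h⟩ := hl.exists_isSubmanifoldAtlas (G := SU k) (ι := psuInclusion k)
    (continuous_psuInclusion k) (injective_psuInclusion k)
    (fun g => LinearMap.pi fun p => (LinearMap.mulLeft ℝ (g : Matrix (Fin k) (Fin k) ℂ)).comp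
      ((LinearMap.mulRight ℝ (g : Matrix (Fin k) (Fin k) ℂ)ᴴ).comp (LinearMap.proj p)))
    (fun g x => by
      induction x using QuotientGroup.induction_on with | _ U
      funext p
      rw [hsmul, psuInclusion_mk]
      change (g.1 * U.1) * _ * (g.1 * U.1)ᴴ = g.1 * ((U.1 * single p.1 p.2 1 * U.1ᴴ) * g.1ᴴ)
      simp only [conjTranspose_mul, mul_assoc])
    (fun g w => by
      funext p
      change g.1ᴴ * ((g.1 * (w p * g.1ᴴ)) * g.1ᴴᴴ) = w p
      rw [conjTranspose_conjTranspose, mul_assoc, mul_assoc, SU.star_mul_self, mul_one, ← mul_assoc,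
        SU.star_mul_self, one_mul])
    (QuotientGroup.mk (1 : SU k))
    (key ▸ contDiff_pi.2 fun p => (suAlgebra.contDiff_coe_exp k).conj _)
    (key ▸ hasFDerivAt_pi.2 hD')
    (fun b hb => by rw [hker b hb, suAlgebra.exp_zero, one_smul])
    (j : EuclideanSpace ℝ (Fin (k ^ 2 - 1)) →L[ℝ] suAlgebra k) j.injective
    (isCompl_range_of_bijective j.surjective hker)
  exact ⟨κ, h₀, fun v => by rw [hκ, hsmul, mul_one]; rfl, h⟩

/-- The charts of `SU(k)` and of the quotient are built from the same `j`, so in them the projection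
is the identity. -/
theorem PSU.exists_isPSUAtlas {k : ℕ} (hk : 1 ≤ k)
    (j : EuclideanSpace ℝ (Fin (k ^ 2 - 1)) ≃L[ℝ] suAlgebra k) :
    ∃ (κ : OpenPartialHomeomorph (EuclideanSpace ℝ (Fin (k ^ 2 - 1))) (PSU k))
      (h₀ : 0 ∈ κ.source), (∀ v, κ v = QuotientGroup.mk (suAlgebra.exp (j v))) ∧
        letI := homogeneousChartedSpace (G := SU k) κ h₀
        IsPSUAtlas k (homogeneousChartedSpace (G := SU k) κ h₀) ∧
          IsManifold (𝓡 (k ^ 2 - 1)) ∞ (PSU k) := by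
  obtain ⟨κ₁, h₁, hκ₁, hs₁⟩ := SU.exists_isSubmanifoldAtlas j
  obtain ⟨κ₂, h₂, hκ₂, hs₂⟩ := PSU.exists_isSubmanifoldAtlas hk j
  refine ⟨κ₂, h₂, hκ₂, ⟨homogeneousChartedSpace (G := SU k) κ₁ h₁, hs₁, hs₂.isManifold, ?_⟩,
    hs₂.isManifold⟩
  let _ := homogeneousChartedSpace (G := SU k) κ₁ h₁
  let _ := homogeneousChartedSpace (G := SU k) κ₂ h₂
  intro g
  obtain ⟨g, rfl⟩ : ∃ h, g = (κ₁.translate h) 0 :=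
    ⟨g, by rw [OpenPartialHomeomorph.translate_apply, hκ₁, map_zero, suAlgebra.exp_zero,
      smul_eq_mul, mul_one]⟩
  refine (isSmoothParam_translate h₁ hs₁.isManifold g).isLocalDiffeomorphAt
    (isSmoothParam_translate h₂ hs₂.isManifold g) (ContinuousLinearEquiv.refl ℝ _) (fun v => ?_)
    h₁ h₂
  rw [OpenPartialHomeomorph.translate_apply, OpenPartialHomeomorph.translate_apply, hκ₁]
  change _ = g • κ₂ v
  rw [hκ₂]
  rfl

/-! ### Orbits of mixed states -/

section LocalAction

variable {m n : ℕ}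

/-- The homomorphism `(U, V) ↦ U ⊗ V` from `SU(m) × SU(n)` to the local unitary group. -/
def localHom (m n : ℕ) : SU m × SU n →* localUnitaryGroup m n where
  toFun p := ⟨⟨p.1.1 ⊗ₖ p.2.1, kronecker_mem_unitary (specialUnitaryGroup_le_unitaryGroup p.1.2)
      (specialUnitaryGroup_le_unitaryGroup p.2.2)⟩,
    p.1.1, specialUnitaryGroup_le_unitaryGroup p.1.2, p.2.1,
    specialUnitaryGroup_le_unitaryGroup p.2.2, rfl⟩
  map_one' := Subtype.ext (Subtype.ext one_kronecker_one)
  map_mul' _ _ := Subtype.ext (Subtype.ext (mul_kronecker_mul _ _ _ _))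

/-- The operator underlying a local unitary transformation. -/
def localOp (g : localUnitaryGroup m n) : Operator m n := g.1.1

theorem localOp_mul (g h : localUnitaryGroup m n) :
    localOp (g * h) = localOp g * localOp h := rfl

theorem localOp_injective :
    Function.Injective (localOp (m := m) (n := n)) :=
  fun _ _ h => Subtype.ext (Subtype.ext h)

theorem localOp_mul_star (g : localUnitaryGroup m n) :
    localOp g * (localOp g)ᴴ = 1 := mem_unitaryGroup_iff.1 g.1.2

theorem localOp_localHom (p : SU m × SU n) :
    localOp (localHom m n p) = p.1.1 ⊗ₖ p.2.1 := rfl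

theorem MixedState.coe_local_smul (g : localUnitaryGroup m n) (W : MixedState m n) :
    ((g • W : MixedState m n) : Operator m n) = localOp g * W.1 * (localOp g)ᴴ := rfl

/-- Every local unitary transformation is a multiple of one by special unitary matrices. -/
theorem exists_localHom_eq_smul (g : localUnitaryGroup m n) :
    ∃ (p : SU m × SU n) (c : ℂ), c * star c = 1 ∧
      localOp (localHom m n p) = c • localOp g := by
  obtain ⟨U, hU, V, hV, hg⟩ := g.2
  obtain ⟨z, hz, hzU⟩ := exists_smul_mem_specialUnitaryGroup hU
  obtain ⟨w, hw, hwV⟩ := exists_smul_mem_specialUnitaryGroup hV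
  refine ⟨(⟨z • U, hzU⟩, ⟨w • V, hwV⟩), z * w, ?_, ?_⟩
  · rw [star_mul', mul_mul_mul_comm, hz, hw, one_mul]
  · rw [localOp_localHom, localOp, hg, smul_kronecker, kronecker_smul,
      smul_smul]

/-- The phase and its conjugate cancel; this is what allows `SU(m) × SU(n)` to replace the local
unitary group. -/
theorem smul_eq_of_localOp_eq_smul {g h : localUnitaryGroup m n} {c : ℂ} (hc : c * star c = 1)
    (hgh : localOp h = c • localOp g) (W : MixedState m n) : h • W = g • W := by
  refine Subtype.ext ?_
  rw [MixedState.coe_local_smul, MixedState.coe_local_smul, hgh, conjTranspose_smul,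
    smul_mul_assoc, smul_mul_smul_comm, hc, one_smul]

theorem mem_center_of_localOp_eq_smul {g h : localUnitaryGroup m n} {c : ℂ}
    (hc : c * star c = 1) (hgh : localOp h = c • localOp g) :
    h ∈ Subgroup.center (localUnitaryGroup m n) ↔ g ∈ Subgroup.center (localUnitaryGroup m n) := by
  have hc0 : c ≠ 0 := fun h => by simp [h] at hc
  simp only [Subgroup.mem_center_iff, ← localOp_injective.eq_iff,
    localOp_mul, hgh, mul_smul_comm, smul_mul_assoc]
  exact forall_congr' fun k => (smul_right_injective _ hc0).eq_iff

theorem kronecker_left_cancel {ι κ : Type*} {A B : Matrix ι ι ℂ} {C : Matrix κ κ ℂ} (hC : C ≠ 0)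
    (h : A ⊗ₖ C = B ⊗ₖ C) : A = B := by
  obtain ⟨i, j, hij⟩ : ∃ i j, C i j ≠ 0 := by
    by_contra! hcon
    exact hC (by ext i j; exact hcon i j)
  ext a b
  have := congrFun (congrFun h (a, i)) (b, j)
  simpa [hij] using this

theorem kronecker_right_cancel {ι κ : Type*} {A B : Matrix ι ι ℂ} {C : Matrix κ κ ℂ} (hC : C ≠ 0)
    (h : C ⊗ₖ A = C ⊗ₖ B) : A = B := by
  obtain ⟨i, j, hij⟩ : ∃ i j, C i j ≠ 0 := by
    by_contra! hcon
    exact hC (by ext i j; exact hcon i j)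
  ext a b
  have := congrFun (congrFun h (i, a)) (j, b)
  simpa [hij] using this

theorem SU.coe_ne_zero (hm : 1 ≤ m) (U : SU m) : (U : Matrix (Fin m) (Fin m) ℂ) ≠ 0 := by
  intro h
  have h1 := SU.star_mul_self U
  have : Nonempty (Fin m) := ⟨⟨0, hm⟩⟩
  rw [h, mul_zero] at h1
  exact zero_ne_one h1

/-- Commuting with `U ⊗ 1` and with `1 ⊗ V` separates the two factors, the other tensor factor being
nonzero and so cancellable. Conversely, central elements of both factors are scalar matrices. -/
theorem localHom_mem_center_iff (hm : 1 ≤ m) (hn : 1 ≤ n) {p : SU m × SU n} :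
    localHom m n p ∈ Subgroup.center (localUnitaryGroup m n) ↔
      p.1 ∈ Subgroup.center (SU m) ∧ p.2 ∈ Subgroup.center (SU n) := by
  constructor
  · intro h
    have hq : ∀ q : SU m × SU n, (q.1.1 * p.1.1) ⊗ₖ (q.2.1 * p.2.1) =
        (p.1.1 * q.1.1) ⊗ₖ (p.2.1 * q.2.1) := by
      intro q
      rw [mul_kronecker_mul, mul_kronecker_mul]
      exact congrArg localOp (Subgroup.mem_center_iff.1 h (localHom m n q))
    refine ⟨Subgroup.mem_center_iff.2 fun U => Subtype.ext ?_,
      Subgroup.mem_center_iff.2 fun V => Subtype.ext ?_⟩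
    · refine kronecker_left_cancel (SU.coe_ne_zero hn p.2) ?_
      have := hq (U, 1)
      simpa using this
    · refine kronecker_right_cancel (SU.coe_ne_zero hm p.1) ?_
      have := hq (1, V)
      simpa using this
  · rintro ⟨h₁, h₂⟩
    obtain ⟨c, hc⟩ := exists_eq_smul_one_of_commute (SU.mem_center_iff.1 h₁)
    obtain ⟨d, hd⟩ := exists_eq_smul_one_of_commute (SU.mem_center_iff.1 h₂)
    refine Subgroup.mem_center_iff.2 fun g => localOp_injective ?_
    rw [localOp_mul, localOp_mul, localOp_localHom,
      hc, hd, smul_kronecker, kronecker_smul, one_kronecker_one]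
    simp

theorem localHom_smul_of_mem_center {p : SU m × SU n}
    (h₁ : p.1 ∈ Subgroup.center (SU m)) (h₂ : p.2 ∈ Subgroup.center (SU n)) (W : MixedState m n) :
    localHom m n p • W = W := by
  obtain ⟨c, hc⟩ := exists_eq_smul_one_of_commute (SU.mem_center_iff.1 h₁)
  obtain ⟨d, hd⟩ := exists_eq_smul_one_of_commute (SU.mem_center_iff.1 h₂)
  refine Subtype.ext ?_
  have hs := localOp_mul_star (localHom m n p)
  have hp : localOp (localHom m n p) = (c * d) • 1 := by
    rw [localOp_localHom, hc, hd, smul_kronecker, kronecker_smul, one_kronecker_one, smul_smul]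
  have hcomm : localOp (localHom m n p) * W.1 = W.1 * localOp (localHom m n p) := by
    rw [hp, smul_mul_assoc, mul_smul_comm, one_mul, mul_one]
  rw [MixedState.coe_local_smul, hcomm, mul_assoc, hs, mul_one]

theorem center_le_isotropyGroup (hm : 1 ≤ m) (hn : 1 ≤ n) (W : MixedState m n) :
    Subgroup.center (localUnitaryGroup m n) ≤ isotropyGroup W := by
  intro g hg
  obtain ⟨p, c, hc, hp⟩ := exists_localHom_eq_smul g
  obtain ⟨h₁, h₂⟩ := (localHom_mem_center_iff hm hn).1
    ((mem_center_of_localOp_eq_smul hc hp).2 hg)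
  rw [MulAction.mem_stabilizer_iff, ← smul_eq_of_localOp_eq_smul hc hp]
  exact localHom_smul_of_mem_center h₁ h₂ W

/-- `SU(m) × SU(n)` acts on the orbits of local unitary transformations. -/
instance (W : MixedState m n) : MulAction (SU m × SU n) (localOrbit W) :=
  MulAction.compHom _ (localHom m n)

theorem localOrbit.coe_smul {W : MixedState m n} (p : SU m × SU n) (X : localOrbit W) :
    ((p • X : localOrbit W) : MixedState m n) = localHom m n p • (X : MixedState m n) := rfl

theorem orbitInclusion_smul {W : MixedState m n} (p : SU m × SU n) (X : localOrbit W) :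
    orbitInclusion W (p • X) = (p.1.1 ⊗ₖ p.2.1) * orbitInclusion W X * (p.1.1 ⊗ₖ p.2.1)ᴴ := rfl

instance (W : MixedState m n) : MulAction.IsPretransitive (SU m × SU n) (localOrbit W) where
  exists_smul_eq X Y := by
    obtain ⟨g, hg⟩ := MulAction.exists_smul_eq (localUnitaryGroup m n) X Y
    obtain ⟨p, c, hc, hp⟩ := exists_localHom_eq_smul g
    refine ⟨p, Subtype.ext ?_⟩
    rw [localOrbit.coe_smul, smul_eq_of_localOp_eq_smul hc hp, ← hg]
    rfl

theorem injective_orbitInclusion (W : MixedState m n) : Function.Injective (orbitInclusion W) :=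
  Subtype.val_injective.comp Subtype.val_injective

theorem isEmbedding_orbitInclusion (W : MixedState m n) : IsEmbedding (orbitInclusion W) :=
  IsEmbedding.subtypeVal.comp IsEmbedding.subtypeVal

theorem Continuous.kronecker {X ι κ : Type*} [TopologicalSpace X] {f : X → Matrix ι ι ℂ}
    {g : X → Matrix κ κ ℂ} (hf : Continuous f) (hg : Continuous g) :
    Continuous fun x => f x ⊗ₖ g x :=
  continuous_matrix fun i j => (hf.matrix_elem i.1 j.1).mul (hg.matrix_elem i.2 j.2)

instance (W : MixedState m n) : ContinuousSMul (SU m × SU n) (localOrbit W) where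
  continuous_smul := by
    refine (isEmbedding_orbitInclusion W).continuous_iff.2 ?_
    have h₁ : Continuous fun x : (SU m × SU n) × localOrbit W => x.1.1.1 ⊗ₖ x.1.2.1 :=
      (continuous_subtype_val.comp (continuous_fst.comp continuous_fst)).kronecker
        (continuous_subtype_val.comp (continuous_snd.comp continuous_fst))
    have h₂ : Continuous fun x : (SU m × SU n) × localOrbit W => orbitInclusion W x.2 :=
      (isEmbedding_orbitInclusion W).continuous.comp continuous_snd
    exact (h₁.mul h₂).mul h₁.matrix_conjTranspose

end LocalAction

/-! ### Orbits of mixed states as submanifolds -/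

/-- Provides the exponential coordinates for an arbitrary orbit: `d` is the codimension of the
isotropy algebra `ker D`. -/
theorem exists_isCompl_range_ker {V E : Type*} [NormedAddCommGroup V] [NormedSpace ℝ V]
    [FiniteDimensional ℝ V] [AddCommGroup E] [Module ℝ E] (D : V →ₗ[ℝ] E) :
    ∃ d ≤ Module.finrank ℝ V, ∃ j : EuclideanSpace ℝ (Fin d) →L[ℝ] V, Function.Injective j ∧
      IsCompl (LinearMap.range (j : EuclideanSpace ℝ (Fin d) →ₗ[ℝ] V)) (LinearMap.ker D) := by
  obtain ⟨P, hP⟩ := Submodule.exists_isCompl (LinearMap.ker D)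
  let j : EuclideanSpace ℝ (Fin (Module.finrank ℝ P)) ≃L[ℝ] P :=
    ContinuousLinearEquiv.ofFinrankEq finrank_euclideanSpace_fin
  refine ⟨_, P.finrank_le, P.subtypeL.comp (j : _ →L[ℝ] P),
    Subtype.val_injective.comp j.injective, ?_⟩
  convert! hP.symm using 1
  ext a
  exact ⟨fun ⟨v, hv⟩ => hv ▸ (j v).2, fun ha => ⟨j.symm ⟨a, ha⟩,
    congrArg Subtype.val (j.apply_symm_apply ⟨a, ha⟩)⟩⟩

section LocalOrbit

variable {m n : ℕ}

/-- The algebra homomorphism `A ↦ A ⊗ 1`. -/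
def kroneckerOne (m n : ℕ) : Matrix (Fin m) (Fin m) ℂ →ₐ[ℝ] Operator m n where
  toFun A := A ⊗ₖ 1
  map_one' := one_kronecker_one
  map_mul' A B := by rw [← mul_kronecker_mul, one_mul]
  map_zero' := zero_kronecker _
  map_add' A B := add_kronecker _ _ _
  commutes' c := by
    rw [Algebra.algebraMap_eq_smul_one, Algebra.algebraMap_eq_smul_one, smul_kronecker,
      one_kronecker_one]

/-- The algebra homomorphism `B ↦ 1 ⊗ B`. -/
def oneKronecker (m n : ℕ) : Matrix (Fin n) (Fin n) ℂ →ₐ[ℝ] Operator m n where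
  toFun B := 1 ⊗ₖ B
  map_one' := one_kronecker_one
  map_mul' A B := by rw [← mul_kronecker_mul, one_mul]
  map_zero' := kronecker_zero _
  map_add' A B := kronecker_add _ _ _
  commutes' c := by
    rw [Algebra.algebraMap_eq_smul_one, Algebra.algebraMap_eq_smul_one, kronecker_smul,
      one_kronecker_one]

theorem kroneckerOne_mul_oneKronecker (A : Matrix (Fin m) (Fin m) ℂ)
    (B : Matrix (Fin n) (Fin n) ℂ) :
    kroneckerOne m n A * oneKronecker m n B = A ⊗ₖ B := by
  change (A ⊗ₖ 1) * (1 ⊗ₖ B) = _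
  rw [← mul_kronecker_mul, one_mul, mul_one]

theorem commute_kroneckerOne_oneKronecker (A : Matrix (Fin m) (Fin m) ℂ)
    (B : Matrix (Fin n) (Fin n) ℂ) : Commute (kroneckerOne m n A) (oneKronecker m n B) := by
  rw [Commute, SemiconjBy, kroneckerOne_mul_oneKronecker]
  change _ = (1 ⊗ₖ B) * (A ⊗ₖ 1)
  rw [← mul_kronecker_mul, one_mul, mul_one]

theorem continuous_kroneckerOne (m n : ℕ) : Continuous (kroneckerOne m n) :=
  continuous_id.kronecker continuous_const

theorem continuous_oneKronecker (m n : ℕ) : Continuous (oneKronecker m n) :=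
  continuous_const.kronecker continuous_id

/-- `A ⊗ 1` and `1 ⊗ B` commute, and both embeddings are continuous algebra homomorphisms, so they
carry exponentials to exponentials. -/
theorem exp_kronecker_exp (A : Matrix (Fin m) (Fin m) ℂ) (B : Matrix (Fin n) (Fin n) ℂ) :
    NormedSpace.exp A ⊗ₖ NormedSpace.exp B =
      NormedSpace.exp (kroneckerOne m n A + oneKronecker m n B) := by
  have h₁ : kroneckerOne m n (NormedSpace.exp A) = NormedSpace.exp (kroneckerOne m n A) :=
    NormedSpace.map_exp (kroneckerOne m n) (continuous_kroneckerOne m n) A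
  have h₂ : oneKronecker m n (NormedSpace.exp B) = NormedSpace.exp (oneKronecker m n B) :=
    NormedSpace.map_exp (oneKronecker m n) (continuous_oneKronecker m n) B
  rw [Matrix.exp_add_of_commute _ _ (commute_kroneckerOne_oneKronecker A B), ← h₁, ← h₂,
    kroneckerOne_mul_oneKronecker]

/-- The derivative at the origin of `(a, b) ↦ exp a ⊗ exp b`. -/
noncomputable def localGenerator (m n : ℕ) : (suAlgebra m × suAlgebra n) →L[ℝ] Operator m n :=
  LinearMap.toContinuousLinearMap
    (((kroneckerOne m n).toLinearMap.comp (suAlgebra m).subtype).coprod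
      ((oneKronecker m n).toLinearMap.comp (suAlgebra n).subtype))

theorem localGenerator_apply (a : suAlgebra m × suAlgebra n) :
    localGenerator m n a = kroneckerOne m n a.1.1 + oneKronecker m n a.2.1 := rfl

theorem conjTranspose_localGenerator (a : suAlgebra m × suAlgebra n) :
    (localGenerator m n a)ᴴ = -localGenerator m n a := by
  rw [localGenerator_apply, conjTranspose_add, neg_add]
  change (a.1.1 ⊗ₖ 1)ᴴ + (1 ⊗ₖ a.2.1)ᴴ = -(a.1.1 ⊗ₖ 1) + -(1 ⊗ₖ a.2.1)
  rw [conjTranspose_kronecker, conjTranspose_kronecker, a.1.2.1, a.2.2.1, conjTranspose_one,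
    conjTranspose_one]
  congr 1
  · ext; simp
  · ext; simp

/-- The exponential map of `SU(m) × SU(n)`. -/
noncomputable abbrev localExp (m n : ℕ) : suAlgebra m × suAlgebra n → SU m × SU n :=
  Prod.map suAlgebra.exp suAlgebra.exp

theorem localOp_localExp (a : suAlgebra m × suAlgebra n) :
    localOp (localHom m n (localExp m n a)) = NormedSpace.exp (localGenerator m n a) :=
  exp_kronecker_exp _ _

theorem contDiff_exp_localGenerator (m n : ℕ) :
    ContDiff ℝ ∞ fun a => NormedSpace.exp (localGenerator m n a) :=
  (contDiff_iff_contDiffAt.2 fun x : Operator m n =>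
    (NormedSpace.exp_analytic (𝕂 := ℝ) x).contDiffAt).comp (localGenerator m n).contDiff

theorem hasFDerivAt_exp_localGenerator (m n : ℕ) :
    HasFDerivAt (fun a => NormedSpace.exp (localGenerator m n a)) (localGenerator m n) 0 := by
  have h : HasFDerivAt (NormedSpace.exp : Operator m n → Operator m n)
    (ContinuousLinearMap.id ℝ _) 0 := (_root_.hasStrictFDerivAt_exp_zero).hasFDerivAt
  rw [← map_zero (localGenerator m n)] at h
  exact h.comp 0 (localGenerator m n).hasFDerivAt

theorem localExp_smul_of_commute {W : MixedState m n} {a : suAlgebra m × suAlgebra n}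
    (h : Commute (localGenerator m n a) W.1) : localHom m n (localExp m n a) • W = W := by
  refine Subtype.ext ?_
  have hs := localOp_mul_star (localHom m n (localExp m n a))
  have hc : Commute (localOp (localHom m n (localExp m n a))) W.1 := by
    rw [localOp_localExp]
    exact h.exp_left
  rw [MixedState.coe_local_smul, hc.eq, mul_assoc, hs, mul_one]

/-- The mixed state `W` as a point of its orbit. -/
abbrev localOrbit.base (W : MixedState m n) : localOrbit W := ⟨W, MulAction.mem_orbit_self W⟩

/-- The commutator with a mixed state, as the derivative of its orbit map. -/
noncomputable def localBracket (W : MixedState m n) :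
    (suAlgebra m × suAlgebra n) →L[ℝ] Operator m n :=
  LinearMap.toContinuousLinearMap
    ((LinearMap.mulRight ℝ W.1 - LinearMap.mulLeft ℝ W.1).comp
      (localGenerator m n : (suAlgebra m × suAlgebra n) →ₗ[ℝ] Operator m n))

theorem localBracket_apply (W : MixedState m n) (a : suAlgebra m × suAlgebra n) :
    localBracket W a = localGenerator m n a * W.1 - W.1 * localGenerator m n a := rfl

theorem localBracket_eq_zero_iff {W : MixedState m n} {a : suAlgebra m × suAlgebra n} :
    localBracket W a = 0 ↔ Commute (localGenerator m n a) W.1 := by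
  rw [localBracket_apply, sub_eq_zero]
  rfl

/-- Generators are skew-Hermitian, so the orbit map has derivative `a ↦ [a, W]` at the origin.
Whatever this kills commutes with `W`, so its exponential fixes `W`, as the general theorem on
orbits requires. -/
theorem localOrbit.exists_isSubmanifoldAtlas (W : MixedState m n) {d : ℕ}
    (j : EuclideanSpace ℝ (Fin d) →L[ℝ] suAlgebra m × suAlgebra n) (hj : Function.Injective j)
    (hc : IsCompl (LinearMap.range (j : EuclideanSpace ℝ (Fin d) →ₗ[ℝ] suAlgebra m × suAlgebra n))
      (LinearMap.ker (localBracket W : suAlgebra m × suAlgebra n →ₗ[ℝ] Operator m n))) :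
    ∃ (κ : OpenPartialHomeomorph (EuclideanSpace ℝ (Fin d)) (localOrbit W)) (h₀ : 0 ∈ κ.source),
      (∀ v, κ v = localExp m n (j v) • localOrbit.base W) ∧
        IsSubmanifoldAtlas (orbitInclusion W)
          (homogeneousChartedSpace (G := SU m × SU n) κ h₀) := by
  obtain ⟨l, hl⟩ := suAlgebra.exists_isExpCoord m
  obtain ⟨l', hl'⟩ := suAlgebra.exists_isExpCoord n
  have key : (fun a => orbitInclusion W (localExp m n a • localOrbit.base W)) =
      fun a => NormedSpace.exp (localGenerator m n a) * W.1 *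
        (NormedSpace.exp (localGenerator m n a))ᴴ := by
    funext a
    rw [← localOp_localExp]
    rfl
  have hD : HasFDerivAt (fun a => orbitInclusion W (localExp m n a • localOrbit.base W))
      (localBracket W) 0 := by
    obtain ⟨D, hD, hD'⟩ := (hasFDerivAt_exp_localGenerator m n).exists_conj
      (by rw [map_zero, NormedSpace.exp_zero]) W.1
    have hDW : D = localBracket W := ContinuousLinearMap.ext fun a => by
      refine (hD a).trans ?_
      change localGenerator m n a * W.1 + W.1 * (localGenerator m n a)ᴴ = _
      rw [conjTranspose_localGenerator, mul_neg, ← sub_eq_add_neg]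
      rfl
    rw [key, ← hDW]
    exact hD'
  have H := (hl.prod hl').exists_isSubmanifoldAtlas (G := SU m × SU n) (X := localOrbit W)
    (ι := orbitInclusion W) (isEmbedding_orbitInclusion W).continuous (injective_orbitInclusion W)
  exact H (fun p => (LinearMap.mulLeft ℝ (localOp (localHom m n p))).comp
      (LinearMap.mulRight ℝ (localOp (localHom m n p))ᴴ))
    (fun p X => by
      rw [orbitInclusion_smul, mul_assoc]
      rfl)
    (fun p w => by
      have h := localOp_mul_star (localHom m n p⁻¹)
      have h' : localOp (localHom m n p) = (localOp (localHom m n p⁻¹))ᴴ := by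
        rw [← inv_inv (localHom m n p), ← map_inv]
        rfl
      simp only [LinearMap.comp_apply, LinearMap.mulLeft_apply, LinearMap.mulRight_apply]
      rw [h', conjTranspose_conjTranspose, mul_assoc, mul_assoc, h, mul_one, ← mul_assoc, h,
        one_mul])
    (localOrbit.base W) (key ▸ (contDiff_exp_localGenerator m n).conj _) hD
    (fun b hb => Subtype.ext (localExp_smul_of_commute (localBracket_eq_zero_iff.1 hb))) j hj hc

theorem exists_orbitHasDim_le (hm : 1 ≤ m) (hn : 1 ≤ n) (W : MixedState m n) :
    ∃ d ≤ m ^ 2 + n ^ 2 - 2, OrbitHasDim W d := by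
  obtain ⟨d, hd, j, hj, hc⟩ := exists_isCompl_range_ker
    (localBracket W : suAlgebra m × suAlgebra n →ₗ[ℝ] Operator m n)
  obtain ⟨κ, h₀, -, h⟩ := localOrbit.exists_isSubmanifoldAtlas W j hj hc
  refine ⟨d, hd.trans ?_, _, h⟩
  rw [Module.finrank_prod, finrank_suAlgebra hm, finrank_suAlgebra hn]
  have := Nat.one_le_pow 2 m hm
  have := Nat.one_le_pow 2 n hn
  omega

/-- Differentiate the commutation relation at `t = 0`. -/
theorem commute_of_forall_exp_smul {k : ℕ} {a A : Matrix (Fin k) (Fin k) ℂ}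
    (h : ∀ t : ℝ, Commute A (NormedSpace.exp (t • a))) : Commute A a := by
  have h₁ : HasDerivAt (fun t : ℝ => NormedSpace.exp (t • a)) a 0 := by
    have h₀ := hasDerivAt_exp_smul_const (𝕂 := ℝ) a (0 : ℝ)
    rw [zero_smul, NormedSpace.exp_zero, one_mul] at h₀
    exact h₀
  have h₂ := h₁.const_mul A
  have h₃ := h₁.mul_const A
  rw [show (fun t : ℝ => A * NormedSpace.exp (t • a)) = fun t : ℝ => NormedSpace.exp (t • a) * A
    from funext fun t => (h t).eq] at h₂
  exact h₂.unique h₃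

/-- If `a` commutes with `W`, the whole one-parameter group `exp (t a)` lies in the isotropy group,
hence in the center. Its generator therefore has scalar components, and these are traceless. -/
theorem eq_zero_of_localBracket_eq_zero (hm : 1 ≤ m) (hn : 1 ≤ n) {W : MixedState m n}
    (hW : isotropyGroup W = Subgroup.center (localUnitaryGroup m n))
    {a : suAlgebra m × suAlgebra n} (ha : localBracket W a = 0) : a = 0 := by
  have h : ∀ t : ℝ, (localExp m n (t • a)).1 ∈ Subgroup.center (SU m) ∧
      (localExp m n (t • a)).2 ∈ Subgroup.center (SU n) := by
    intro t
    refine (localHom_mem_center_iff hm hn).1 (hW ▸ localExp_smul_of_commute ?_)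
    rw [map_smul]
    exact (localBracket_eq_zero_iff.1 ha).smul_left t
  refine Prod.ext ?_ ?_
  · exact suAlgebra.eq_zero_of_commute hm fun A =>
      commute_of_forall_exp_smul fun t => SU.mem_center_iff.1 (h t).1 A
  · exact suAlgebra.eq_zero_of_commute hn fun A =>
      commute_of_forall_exp_smul fun t => SU.mem_center_iff.1 (h t).2 A

end LocalOrbit

/-! ### A mixed state with minimal isotropy group -/

section Generic

open scoped MatrixOrder Matrix.Norms.L2Operator in
-- In the operator norm `H ≥ -‖H‖`, so `c = ‖H‖ + 1` suffices.
theorem Matrix.IsHermitian.exists_posDef_add {ι : Type*} [Fintype ι] [DecidableEq ι]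
    {H : Matrix ι ι ℂ} (hH : H.IsHermitian) : ∃ c : ℝ, (c • 1 + H).PosDef := by
  have h := IsSelfAdjoint.neg_algebraMap_norm_le_self (a := H) hH
  rw [neg_le_iff_add_nonneg'] at h
  refine ⟨‖H‖ + 1, ?_⟩
  rw [add_smul, one_smul, add_right_comm, ← Algebra.algebraMap_eq_smul_one]
  exact PosDef.posSemidef_add (Matrix.nonneg_iff_posSemidef.1 h) PosDef.one

variable {m n : ℕ}

/-- The partial trace over the second factor. -/
def traceRight (X : Operator m n) : Matrix (Fin m) (Fin m) ℂ :=
  of fun i j => ∑ k, X (i, k) (j, k)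

/-- The partial trace over the first factor. -/
def traceLeft (X : Operator m n) : Matrix (Fin n) (Fin n) ℂ :=
  of fun i j => ∑ k, X (k, i) (k, j)

theorem traceRight_add (X Y : Operator m n) : traceRight (X + Y) = traceRight X + traceRight Y := by
  ext i j
  simp [traceRight, Finset.sum_add_distrib]

theorem traceLeft_add (X Y : Operator m n) : traceLeft (X + Y) = traceLeft X + traceLeft Y := by
  ext i j
  simp [traceLeft, Finset.sum_add_distrib]

theorem traceRight_kronecker (A : Matrix (Fin m) (Fin m) ℂ) (B : Matrix (Fin n) (Fin n) ℂ) :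
    traceRight (A ⊗ₖ B) = B.trace • A := by
  ext i j
  simp [traceRight, trace, Finset.mul_sum, mul_comm]

theorem traceLeft_kronecker (A : Matrix (Fin m) (Fin m) ℂ) (B : Matrix (Fin n) (Fin n) ℂ) :
    traceLeft (A ⊗ₖ B) = A.trace • B := by
  ext i j
  simp [traceLeft, trace, Finset.sum_mul]

/-- A diagonal matrix with distinct eigenvalues. -/
def ladder (k : ℕ) : Matrix (Fin k) (Fin k) ℂ := diagonal fun i => (i : ℂ)

/-- A traceless Hermitian matrix with no zero entry off the diagonal. -/
def coupling (k : ℕ) : Matrix (Fin k) (Fin k) ℂ :=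
  -- The diagonal is `1, -1, 0, …`: for `k ≥ 2` its sum is 0, so partial traces kill the coupling
  -- term, while the nonzero corner entry lets one factor be read off from the tensor product.
  of fun i j => if i = j then (if i.1 = 0 then 1 else if i.1 = 1 then -1 else 0) else 1

theorem isHermitian_ladder (k : ℕ) : (ladder k).IsHermitian := by
  rw [IsHermitian, ladder, diagonal_conjTranspose]
  congr 1
  ext i
  simp

theorem isHermitian_coupling (k : ℕ) : (coupling k).IsHermitian := by
  ext i j
  rw [conjTranspose_apply]
  simp only [coupling, of_apply]
  by_cases h : i = j
  · subst h
    simp only [if_true]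
    split_ifs <;> simp
  · simp [h, Ne.symm h]

theorem trace_coupling {k : ℕ} (hk : 2 ≤ k) : (coupling k).trace = 0 := by
  obtain ⟨k, rfl⟩ := Nat.exists_eq_add_of_le' hk
  simp [coupling, trace, Fin.sum_univ_succ]

theorem apply_eq_zero_of_commute_ladder {k : ℕ} {U : Matrix (Fin k) (Fin k) ℂ}
    (h : Commute U (ladder k)) {i j : Fin k} (hij : i ≠ j) : U i j = 0 := by
  have h' := congrFun (congrFun h.eq i) j
  rw [ladder, mul_diagonal, diagonal_mul, mul_comm, ← sub_eq_zero, ← sub_mul] at h'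
  refine (mul_eq_zero.1 h').resolve_left (sub_ne_zero.2 fun h => hij ?_)
  exact (Fin.ext (by exact_mod_cast h)).symm

/-- A Hermitian operator that commutes with no local unitary transformations but scalars. -/
def genericOperator (m n : ℕ) : Operator m n :=
  ladder m ⊗ₖ 1 + 1 ⊗ₖ ladder n + coupling m ⊗ₖ coupling n

theorem isHermitian_genericOperator (m n : ℕ) : (genericOperator m n).IsHermitian := by
  rw [IsHermitian, genericOperator, conjTranspose_add, conjTranspose_add, conjTranspose_kronecker,
    conjTranspose_kronecker, conjTranspose_kronecker, isHermitian_ladder, isHermitian_ladder,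
    isHermitian_coupling, isHermitian_coupling, conjTranspose_one, conjTranspose_one]

theorem kronecker_conj (U A : Matrix (Fin m) (Fin m) ℂ) (V B : Matrix (Fin n) (Fin n) ℂ) :
    (U ⊗ₖ V) * (A ⊗ₖ B) * (U ⊗ₖ V)ᴴ = (U * A * Uᴴ) ⊗ₖ (V * B * Vᴴ) := by
  rw [conjTranspose_kronecker, mul_kronecker_mul, mul_kronecker_mul]

theorem SU.trace_conj {k : ℕ} (U : SU k) (A : Matrix (Fin k) (Fin k) ℂ) :
    (U.1 * A * U.1ᴴ).trace = A.trace := by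
  rw [trace_mul_cycle, SU.star_mul_self, one_mul]

theorem SU.commute_of_conj {k : ℕ} {U : SU k} {A : Matrix (Fin k) (Fin k) ℂ}
    (h : U.1 * A * U.1ᴴ = A) : Commute U.1 A := by
  change U.1 * A = A * U.1
  rw [← congrArg (· * U.1) h]
  simp only [mul_assoc, SU.star_mul_self, mul_one]

theorem SU.conj_genericOperator (U : SU m) (V : SU n) :
    (U.1 ⊗ₖ V.1) * genericOperator m n * (U.1 ⊗ₖ V.1)ᴴ = (U.1 * ladder m * U.1ᴴ) ⊗ₖ 1 +
      1 ⊗ₖ (V.1 * ladder n * V.1ᴴ) +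
        (U.1 * coupling m * U.1ᴴ) ⊗ₖ (V.1 * coupling n * V.1ᴴ) := by
  rw [genericOperator, mul_add, mul_add, add_mul, add_mul, kronecker_conj, kronecker_conj,
    kronecker_conj, mul_one, mul_one, SU.mul_star_self, SU.mul_star_self]

section Diagonal

variable {k : ℕ} {U : SU k}

theorem SU.eq_diagonal (hU : ∀ i j, i ≠ j → U.1 i j = 0) : U.1 = diagonal fun i => U.1 i i := by
  ext i j
  by_cases hij : i = j
  · rw [hij, diagonal_apply_eq]
  · rw [hU i j hij, diagonal_apply_ne _ hij]

theorem SU.conj_apply (hU : ∀ i j, i ≠ j → U.1 i j = 0) (A : Matrix (Fin k) (Fin k) ℂ)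
    (i j : Fin k) :
    (U.1 * A * U.1ᴴ) i j = U.1 i i * A i j * star (U.1 j j) := by
  conv_lhs => rw [SU.eq_diagonal hU, diagonal_conjTranspose, mul_diagonal, diagonal_mul]
  rfl

theorem SU.mul_star_apply_self (hU : ∀ i j, i ≠ j → U.1 i j = 0) (i : Fin k) :
    U.1 i i * star (U.1 i i) = 1 := by
  have h := SU.conj_apply hU 1 i i
  rwa [mul_one, SU.mul_star_self, one_apply_eq, mul_one, eq_comm] at h

/-- For diagonal `U` the condition reads `U i i * star (U j j) = 1`. As `U j j` has modulus one, all
diagonal entries agree. -/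
theorem SU.mem_center_of_conj_coupling (hU : ∀ i j, i ≠ j → U.1 i j = 0) (hk : 1 ≤ k)
    (h : ∀ i j, i ≠ j → (U.1 * coupling k * U.1ᴴ) i j = 1) : U ∈ Subgroup.center (SU k) := by
  have heq : ∀ i j, U.1 i i = U.1 j j := by
    intro i j
    by_cases hij : i = j
    · rw [hij]
    · have h₁ := h i j hij
      rw [SU.conj_apply hU, show coupling k i j = 1 by simp [coupling, hij], mul_one] at h₁
      calc U.1 i i = U.1 i i * (U.1 j j * star (U.1 j j)) := by
            rw [SU.mul_star_apply_self hU, mul_one]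
        _ = U.1 j j := by rw [mul_left_comm, h₁, mul_one]
  refine SU.mem_center_iff.2 fun A => ?_
  rw [show U.1 = U.1 ⟨0, hk⟩ ⟨0, hk⟩ • 1 by
    rw [smul_one_eq_diagonal]
    exact (SU.eq_diagonal hU).trans (congrArg diagonal (funext fun i => heq _ _))]
  exact (Commute.one_right A).smul_right _

end Diagonal

/-- A partial trace removes the traceless coupling term and turns the other ladder into a multiple
of 1 unaffected by conjugation. Hence `U` and `V` commute with their ladders, whose eigenvalues are
distinct, and are diagonal. -/
theorem SU.mem_center_of_conj_genericOperator (hm : 2 ≤ m) (hn : 2 ≤ n) {U : SU m} {V : SU n}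
    (h : (U.1 ⊗ₖ V.1) * genericOperator m n * (U.1 ⊗ₖ V.1)ᴴ = genericOperator m n) :
    U ∈ Subgroup.center (SU m) ∧ V ∈ Subgroup.center (SU n) := by
  rw [SU.conj_genericOperator, genericOperator] at h
  have hA : U.1 * ladder m * U.1ᴴ = ladder m := by
    have hn' : (n : ℂ) ≠ 0 := by exact_mod_cast (by omega : n ≠ 0)
    have := congrArg traceRight h
    simp only [traceRight_add, traceRight_kronecker, SU.trace_conj, trace_coupling hn, zero_smul,
      add_zero, add_left_inj, trace_one, Fintype.card_fin] at this
    exact smul_right_injective _ hn' this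
  have hB : V.1 * ladder n * V.1ᴴ = ladder n := by
    have hm' : (m : ℂ) ≠ 0 := by exact_mod_cast (by omega : m ≠ 0)
    have := congrArg traceLeft h
    simp only [traceLeft_add, traceLeft_kronecker, SU.trace_conj, trace_coupling hm, zero_smul,
      add_zero, add_right_inj, trace_one, Fintype.card_fin] at this
    exact smul_right_injective _ hm' this
  rw [hA, hB, add_right_inj] at h
  have hU : ∀ i j, i ≠ j → U.1 i j = 0 := fun i j =>
    apply_eq_zero_of_commute_ladder (SU.commute_of_conj hA)
  have hV : ∀ i j, i ≠ j → V.1 i j = 0 := fun i j =>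
    apply_eq_zero_of_commute_ladder (SU.commute_of_conj hB)
  have hcorner : ∀ {k : ℕ} (hk : 0 < k), coupling k ⟨0, hk⟩ ⟨0, hk⟩ = 1 := fun hk => by
    simp [coupling]
  refine ⟨SU.mem_center_of_conj_coupling hU (by omega) fun i j hij => ?_,
    SU.mem_center_of_conj_coupling hV (by omega) fun i j hij => ?_⟩
  -- At the corner entry of the second factor, the diagonal `V` contributes `V 0 0 * star (V 0 0) =
  -- 1`, which leaves a condition on `U` alone.
  · have h' := congrFun (congrFun h (i, ⟨0, by omega⟩)) (j, ⟨0, by omega⟩)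
    rw [kronecker_apply, kronecker_apply, SU.conj_apply hV, hcorner, mul_one, mul_one,
      SU.mul_star_apply_self hV, mul_one] at h'
    rw [h']
    simp [coupling, hij]
  · have h' := congrFun (congrFun h (⟨0, by omega⟩, i)) (⟨0, by omega⟩, j)
    rw [kronecker_apply, kronecker_apply, SU.conj_apply hU, hcorner, mul_one, one_mul,
      SU.mul_star_apply_self hU, one_mul] at h'
    rw [h']
    simp [coupling, hij]

theorem exists_isotropyGroup_eq_center (hm : 2 ≤ m) (hn : 2 ≤ n) :
    ∃ W : MixedState m n, isotropyGroup W = Subgroup.center (localUnitaryGroup m n) := by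
  have : Nonempty (Fin m × Fin n) := ⟨(⟨0, by omega⟩, ⟨0, by omega⟩)⟩
  obtain ⟨c, hc⟩ := (isHermitian_genericOperator m n).exists_posDef_add
  set X := c • 1 + genericOperator m n with hX
  -- Adding a multiple of 1 and dividing by the trace turn the generic operator into a state without
  -- changing which local unitaries fix it.
  have htr : 0 < X.trace := hc.trace_pos
  refine ⟨⟨X.trace⁻¹ • X, hc.posSemidef.smul (inv_nonneg.2 htr.le), ?_⟩,
    le_antisymm (fun g hg => ?_) (center_le_isotropyGroup (by omega) (by omega) _)⟩
  · rw [trace_smul, smul_eq_mul, inv_mul_cancel₀ htr.ne']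
  · obtain ⟨p, z, hz, hp⟩ := exists_localHom_eq_smul g
    rw [MulAction.mem_stabilizer_iff, ← smul_eq_of_localOp_eq_smul hz hp] at hg
    have hg' := congrArg Subtype.val hg
    rw [MixedState.coe_local_smul] at hg'
    change localOp (localHom m n p) * (X.trace⁻¹ • X) * (localOp (localHom m n p))ᴴ =
      X.trace⁻¹ • X at hg'
    rw [mul_smul_comm, smul_mul_assoc] at hg'
    have hg'' := smul_right_injective _ (inv_ne_zero htr.ne') hg'
    simp only [hX] at hg''
    rw [mul_add, add_mul, mul_smul_comm, smul_mul_assoc, mul_one, localOp_mul_star,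
      add_right_inj] at hg''
    rw [← mem_center_of_localOp_eq_smul hz hp, localHom_mem_center_iff (by omega) (by omega)]
    exact SU.mem_center_of_conj_genericOperator hm hn hg''

end Generic

/-! ### Generic orbits -/

section GenericOrbit

variable {m n : ℕ}

/-- The map `SU(m)/Z_m × SU(n)/Z_n → localOrbit W` induced by the orbit map of `W`. -/
noncomputable def psuOrbitMap (W : MixedState m n) (x : PSU m × PSU n) : localOrbit W :=
  (x.1.out, x.2.out) • localOrbit.base W

theorem psuOrbitMap_mk (W : MixedState m n) (U : SU m) (V : SU n) :
    psuOrbitMap W (QuotientGroup.mk U, QuotientGroup.mk V) = (U, V) • localOrbit.base W := by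
  obtain ⟨z, hz⟩ := QuotientGroup.mk_out_eq_mul (Subgroup.center (SU m)) U
  obtain ⟨w, hw⟩ := QuotientGroup.mk_out_eq_mul (Subgroup.center (SU n)) V
  have h : ((z : SU m), (w : SU n)) • localOrbit.base W = localOrbit.base W :=
    Subtype.ext (localHom_smul_of_mem_center (p := (z.1, w.1)) z.2 w.2 W)
  change ((QuotientGroup.mk U : PSU m).out, (QuotientGroup.mk V : PSU n).out) •
    localOrbit.base W = _
  rw [hz, hw, ← Prod.mk_mul_mk, mul_smul, h]

/-- Injectivity is the assumption that only central elements fix `W`; surjectivity is transitivity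
of `SU(m) × SU(n)` on the orbit. -/
theorem bijective_psuOrbitMap (hm : 1 ≤ m) (hn : 1 ≤ n) {W : MixedState m n}
    (hW : isotropyGroup W = Subgroup.center (localUnitaryGroup m n)) :
    Function.Bijective (psuOrbitMap W) := by
  constructor
  · rintro ⟨x, y⟩ ⟨x', y'⟩ h
    induction x using QuotientGroup.induction_on with | _ U
    induction y using QuotientGroup.induction_on with | _ V
    induction x' using QuotientGroup.induction_on with | _ U'
    induction y' using QuotientGroup.induction_on with | _ V'
    rw [psuOrbitMap_mk, psuOrbitMap_mk] at h
    have h' : localHom m n ((U, V)⁻¹ * (U', V')) ∈ isotropyGroup W := by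
      have e : ((U, V)⁻¹ * (U', V')) • localOrbit.base W = localOrbit.base W := by
        rw [mul_smul, ← h, inv_smul_smul]
      exact congrArg Subtype.val e
    rw [hW, localHom_mem_center_iff hm hn] at h'
    exact Prod.ext (QuotientGroup.eq.2 h'.1) (QuotientGroup.eq.2 h'.2)
  · intro X
    obtain ⟨⟨U, V⟩, h⟩ := MulAction.exists_smul_eq (SU m × SU n) (localOrbit.base W) X
    exact ⟨(QuotientGroup.mk U, QuotientGroup.mk V), (psuOrbitMap_mk W U V).trans h⟩

/-- The isotropy algebra is zero, so `su(m) × su(n)` coordinatizes both the product of quotients and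
the orbit. In translated charts `psuOrbitMap` is the linear map `L.symm`, so this bijection is a
local diffeomorphism and thus a diffeomorphism. -/
theorem exists_diffeomorph_localOrbit (hm : 1 ≤ m) (hn : 1 ≤ n)
    {jm : EuclideanSpace ℝ (Fin (m ^ 2 - 1)) ≃L[ℝ] suAlgebra m}
    {jn : EuclideanSpace ℝ (Fin (n ^ 2 - 1)) ≃L[ℝ] suAlgebra n}
    {κm : OpenPartialHomeomorph (EuclideanSpace ℝ (Fin (m ^ 2 - 1))) (PSU m)}
    {κn : OpenPartialHomeomorph (EuclideanSpace ℝ (Fin (n ^ 2 - 1))) (PSU n)}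
    (h₀m : 0 ∈ κm.source) (h₀n : 0 ∈ κn.source)
    (hκm : ∀ v, κm v = QuotientGroup.mk (suAlgebra.exp (jm v)))
    (hκn : ∀ v, κn v = QuotientGroup.mk (suAlgebra.exp (jn v)))
    (hMm : letI := homogeneousChartedSpace (G := SU m) κm h₀m
      IsManifold (𝓡 (m ^ 2 - 1)) ∞ (PSU m))
    (hMn : letI := homogeneousChartedSpace (G := SU n) κn h₀n
      IsManifold (𝓡 (n ^ 2 - 1)) ∞ (PSU n))
    {W : MixedState m n} (hW : isotropyGroup W = Subgroup.center (localUnitaryGroup m n)) :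
    letI := homogeneousChartedSpace (G := SU m) κm h₀m
    letI := homogeneousChartedSpace (G := SU n) κn h₀n
    ∃ c : ChartedSpace (EuclideanSpace ℝ (Fin (m ^ 2 + n ^ 2 - 2))) (localOrbit W),
      IsSubmanifoldAtlas (orbitInclusion W) c ∧
      Nonempty (Diffeomorph ((𝓡 (m ^ 2 - 1)).prod (𝓡 (n ^ 2 - 1))) (𝓡 (m ^ 2 + n ^ 2 - 2))
        (PSU m × PSU n) (localOrbit W) ∞) := by
  let L : EuclideanSpace ℝ (Fin (m ^ 2 + n ^ 2 - 2)) ≃L[ℝ]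
      EuclideanSpace ℝ (Fin (m ^ 2 - 1)) × EuclideanSpace ℝ (Fin (n ^ 2 - 1)) :=
    ContinuousLinearEquiv.ofFinrankEq (by
      have := Nat.one_le_pow 2 m hm
      have := Nat.one_le_pow 2 n hn
      simp only [Module.finrank_prod, finrank_euclideanSpace_fin]
      omega)
  let j := L.trans (jm.prodCongr jn)
  obtain ⟨κ, h₀, hκ, h⟩ := localOrbit.exists_isSubmanifoldAtlas W
    (j : EuclideanSpace ℝ (Fin (m ^ 2 + n ^ 2 - 2)) →L[ℝ] suAlgebra m × suAlgebra n) j.injective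
    (isCompl_range_of_bijective j.surjective fun a ha =>
      eq_zero_of_localBracket_eq_zero hm hn hW ha)
  let _ := homogeneousChartedSpace (G := SU m) κm h₀m
  let _ := homogeneousChartedSpace (G := SU n) κn h₀n
  let _ := homogeneousChartedSpace (G := SU m × SU n) κ h₀
  refine ⟨_, h, ⟨IsLocalDiffeomorph.diffeomorphOfBijective (f := psuOrbitMap W) (fun x => ?_)
    (bijective_psuOrbitMap hm hn hW)⟩⟩
  obtain ⟨U, V, rfl⟩ : ∃ U V, x = ((κm.translate U).prod (κn.translate V)) 0 := by
    obtain ⟨x, y⟩ := x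
    induction x using QuotientGroup.induction_on with | _ U
    induction y using QuotientGroup.induction_on with | _ V
    refine ⟨U, V, Prod.ext ?_ ?_⟩
    · change _ = U • κm 0
      rw [hκm, map_zero, suAlgebra.exp_zero]
      exact congrArg QuotientGroup.mk (mul_one U).symm
    · change _ = V • κn 0
      rw [hκn, map_zero, suAlgebra.exp_zero]
      exact congrArg QuotientGroup.mk (mul_one V).symm
  refine ((isSmoothParam_translate h₀m hMm U).prod
    (isSmoothParam_translate h₀n hMn V)).isLocalDiffeomorphAt
    (isSmoothParam_translate h₀ h.isManifold (U, V)) L.symm (fun v => ?_) ⟨h₀m, h₀n⟩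
    (by rw [map_zero]; exact h₀)
  have hj : j (L.symm v) = (jm v.1, jn v.2) := by
    change (jm.prodCongr jn) (L (L.symm v)) = _
    rw [L.apply_symm_apply]
    rfl
  have hv : ((κm.translate U).prod (κn.translate V)) v =
      (QuotientGroup.mk (U * suAlgebra.exp (jm v.1)),
        QuotientGroup.mk (V * suAlgebra.exp (jn v.2))) := by
    change (U • κm v.1, V • κn v.2) = _
    rw [hκm, hκn]
    rfl
  rw [hv, psuOrbitMap_mk]
  change _ = (U, V) • κ (L.symm v)
  rw [hκ]
  change _ = (U, V) • localExp m n (j (L.symm v)) • localOrbit.base W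
  rw [hj, ← mul_smul]
  rfl

end GenericOrbit

theorem theorem1 (m n : ℕ) (hm : 2 ≤ m) (hmn : m ≤ n) :
    -- every orbit has a dimension, and the maximal one is `m ^ 2 + n ^ 2 - 2`
    ((∀ W : MixedState m n, ∃ d : ℕ, OrbitHasDim W d) ∧
      IsGreatest {d : ℕ | ∃ W : MixedState m n, OrbitHasDim W d} (m ^ 2 + n ^ 2 - 2)) ∧
    -- the least isotropy subgroup is the center
    IsLeast (Set.range fun W : MixedState m n => isotropyGroup W)
      (Subgroup.center (localUnitaryGroup m n)) ∧
    -- an orbit with this isotropy subgroup is diffeomorphic to `SU(m)/Z_m × SU(n)/Z_n`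
    ∃ (qm : ChartedSpace (EuclideanSpace ℝ (Fin (m ^ 2 - 1))) (PSU m))
      (qn : ChartedSpace (EuclideanSpace ℝ (Fin (n ^ 2 - 1))) (PSU n)),
      IsPSUAtlas m qm ∧ IsPSUAtlas n qn ∧
      ∀ W : MixedState m n, isotropyGroup W = Subgroup.center (localUnitaryGroup m n) →
        ∃ c : ChartedSpace (EuclideanSpace ℝ (Fin (m ^ 2 + n ^ 2 - 2))) (localOrbit W),
          IsSubmanifoldAtlas (orbitInclusion W) c ∧
          Nonempty (Diffeomorph ((𝓡 (m ^ 2 - 1)).prod (𝓡 (n ^ 2 - 1))) (𝓡 (m ^ 2 + n ^ 2 - 2))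
            (PSU m × PSU n) (localOrbit W) ∞) := by
  have hm' : 1 ≤ m := by omega
  have hn' : 1 ≤ n := by omega
  obtain ⟨W₀, hW₀⟩ := exists_isotropyGroup_eq_center hm (hm.trans hmn)
  let jm : EuclideanSpace ℝ (Fin (m ^ 2 - 1)) ≃L[ℝ] suAlgebra m :=
    ContinuousLinearEquiv.ofFinrankEq (by rw [finrank_euclideanSpace_fin, finrank_suAlgebra hm'])
  let jn : EuclideanSpace ℝ (Fin (n ^ 2 - 1)) ≃L[ℝ] suAlgebra n :=
    ContinuousLinearEquiv.ofFinrankEq (by rw [finrank_euclideanSpace_fin, finrank_suAlgebra hn'])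
  obtain ⟨κm, h₀m, hκm, hqm, hMm⟩ := PSU.exists_isPSUAtlas hm' jm
  obtain ⟨κn, h₀n, hκn, hqn, hMn⟩ := PSU.exists_isPSUAtlas hn' jn
  have hgen := fun (W : MixedState m n) hW =>
    exists_diffeomorph_localOrbit hm' hn' h₀m h₀n hκm hκn hMm hMn (W := W) hW
  refine ⟨⟨fun W => ?_, ?_, ?_⟩, ⟨⟨W₀, hW₀⟩, ?_⟩, _, _, hqm, hqn, hgen⟩
  · obtain ⟨d, -, h⟩ := exists_orbitHasDim_le hm' hn' W
    exact ⟨d, h⟩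
  · obtain ⟨c, hc, -⟩ := hgen W₀ hW₀
    exact ⟨W₀, c, hc⟩
  · rintro d ⟨W, c, hc⟩
    -- The bound is known for the atlas constructed on the orbit; uniqueness of the dimension
    -- carries it over to an arbitrary one.
    obtain ⟨d', hd', c', hc'⟩ := exists_orbitHasDim_le hm' hn' W
    have : Nonempty (localOrbit W) := ⟨localOrbit.base W⟩
    exact (hc.dim_unique hc').trans_le hd'
  · rintro _ ⟨W, rfl⟩
    exact center_le_isotropyGroup hm' hn' W
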